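/- **Setting.** Let $\mathcal A$ (actions) and $\mathcal E$ (percepts) be finite alphabets, $\Sigma=\mathcal A\sqcup\mathcal E$; each percept $e$ carries a reward $r(e)\in[0,1]$. Let $\gamma_t\ge 0$ with $\sum_t\gamma_t<\infty$ and $\Gamma_t=\sum_{k\ge t}\gamma_k$. Machines are probabilistic Turing machines with access to an oracle; an oracle $O$ assigns to a machine $T$, a string $x\in\Sigma^*$, a rational $p$ and a symbol $\alpha\in\Sigma$ the probability $O_\alpha(T,x,p)\in[0,1]$ that the query is answered by $1$ (else $0$), independently at each call. Let $\lambda_T^O(\alpha|x)$ be the probability that $T$ with oracle $O$ outputs exactly the symbol $\alpha$ on input $x$. The oracle $O$ is a (typed) *reflective oracle* if for all $T,x$ there are numbers $(q_\alpha)_{\alpha\in\Sigma}$ such that $\sum_{\alpha\in\mathcal A}q_\alpha=1=\sum_{\alpha\in\mathcal E}q_\alpha$ and, for every $\alpha\in\Sigma$ and $p\in\mathbb Q$: $\lambda_T^O(\alpha|x)\le q_\alpha\le 1-\sum_{\beta\ne\alpha}\lambda_T^O(\beta|x)$ (sum over $\beta$ of the same type as $\alpha$), $O_\alpha(T,x,p)=1$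 if $p<q_\alpha$, and $O_\alpha(T,x,p)=0$ if $p>q_\alpha$. The $q_\alpha$ are then unique, and one writes $\bar\lambda_T^O(\alpha|x)=q_\alpha$. A *policy* is a map $\pi:(\mathcal A\times\mathcal E)^*\to\Delta\mathcal A$; it is *reflective-oracle computable* if $\pi(a|h)=\lambda_T^O(a|h)$ for some $T$ and all $h,a$. Let $\mathcal M^O_{\rm refl}$ be the set of all environments $\nu(e|ha)=\bar\lambda_T^O(e|ha)$, for machines $T$. An *$n$-player game* is a map $\sigma:(\mathcal A^n\times\mathcal E^n)^*\times\mathcal A^n\to\Delta(\mathcal E^n)$; it is reflective-oracle computable if there is a machine with oracle $O$ that, on every input (a joint history and an action vector, written as a string over $\Sigma$), outputs each percept vector $e\in\mathcal E^n$, written as a string of $n$ percepts, with the probability that $\sigma$ gives it. For a policy $\pi$, an environment $\nu$ and a history $h_{<t}$ of $t-1$ interactions, the value is $$V_\nu^\pi(h_{<t})=\frac1{\Gamma_t}\lim_{m\to\infty}\sum_{a_te_t\cdots a_me_m}\Big(\sum_{k=t}^m\gamma_k r(e_k)\Big)\prod_{j=t}^m\pi(a_j|h_{<j})\,\nu(e_j|h_{<j}a_j)$$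 (and $0$ if $\Gamma_t=0$), where $h_{<j}=h_{<t}a_te_t\cdots a_{j-1}e_{j-1}$, and $V^*_\nu(h)=\sup_\pi V^\pi_\nu(h)$. A policy $\pi$ is *asymptotically optimal in mean* in $\mathcal M^O_{\rm refl}$ if for each $\mu\in\mathcal M^O_{\rm refl}$ one has $\mathbb E^\pi_\mu[V^*_\mu(h_{<t})-V^\pi_\mu(h_{<t})]\to0$ as $t\to\infty$, where $h_{<t}$ is the history of the first $t-1$ interactions of $\pi$ with $\mu$. Policies $\pi_1,\dots,\pi_n$ and a game $\sigma$ induce the distribution $\sigma^{\pi_{1:n}}$ of joint histories, in which in each step, independently given the past, every player $j$ draws an action from $\pi_j$ given the sequence $h^j$ of their own past actions and percepts, and then $\sigma$ draws the percept vector. Player $i$'s *subjective environment* $\sigma_i$ is given by the conditional probability $\sigma_i(e|ha)$ that player $i$ receives the percept $e$ after own history $h$ and own action $a$; it depends on $\sigma$ and on $\pi_j$, $j\neq i$, but not on $\pi_i$. For $\varepsilon>0$, the policy $\pi_i$ is an *$\varepsilon$-best response* at time $t$ if $V^*_{\sigma_i}(h^i_{<t})-V^{\pi_i}_{\sigma_i}(h^i_{<t})<\varepsilon$.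 **Theorem (convergence to equilibrium).** Let $O$ be a reflective oracle, let $\sigma$ be a reflective-oracle computable $n$-player game, and let $\pi_1,\dots,\pi_n$ be reflective-oracle computable policies that are asymptotically optimal in mean in $\mathcal M^O_{\rm refl}$. Then for all $\varepsilon>0$ and all $i\in\{1,\dots,n\}$, the $\sigma^{\pi_{1:n}}$-probability that $\pi_i$ is an $\varepsilon$-best response at time $t$ converges to $1$ as $t\to\infty$. -/

import Mathlib

open Filter Topology
open scoped ENNReal

namespace ReflGame

noncomputable section

/-! ## Probabilistic oracle machines -/

/-- A probabilistic oracle machine is given by its program: a (partial recursive) code that maps the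
current configuration, a natural number, to the coded next move. Every program is allowed; a
machine whose program diverges, or returns a number that codes no move, never halts. -/
abbrev Machine : Type := Nat.Partrec.Code

/-- What a machine with symbols in `S` can do in one step: pass to another configuration, flip a fair
coin, ask the oracle the question `(T, x, p, α)` (going to `c₁` on answer 1 and to `c₀` on answer 0),
or halt with an output string. -/
inductive Move (S : Type*) where
  | halt (y : List S)
  | next (c : ℕ)
  | flip (c₀ c₁ : ℕ)
  | query (T : Machine) (x : List S) (p : ℚ) (α : S) (c₁ c₀ : ℕ)

/-- The move coded by a natural number; the rational number of a query is written as a pair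
`(k, d)` that stands for `k / (d + 1)`. -/
def Move.ofNat {S : Type*} [Primcodable S] (m : ℕ) : Option (Move S) :=
  (Encodable.decode m :
      Option (List S ⊕ ℕ ⊕ (ℕ × ℕ) ⊕ ((Machine × List S × (ℕ × ℕ) × S) × ℕ × ℕ))).map fun
    | .inl y => .halt y
    | .inr (.inl c) => .next c
    | .inr (.inr (.inl (c₀, c₁))) => .flip c₀ c₁
    | .inr (.inr (.inr ((T, x, (k, d), α), c₁, c₀))) => .query T x ((k : ℚ) / (d + 1)) α c₁ c₀

/-- An oracle: `O T x p α` is the probability that a call of `O_α(T, x, p)` is answered by 1. -/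
abbrev Oracle (S : Type*) : Type _ := Machine → List S → ℚ → S → unitInterval

open Classical in
/-- The move of the machine `T` in configuration `c`, if there is one. -/
def Machine.step {S : Type*} [Primcodable S] (T : Machine) (c : ℕ) : Option (Move S) :=
  (Nat.Partrec.Code.eval T c).toOption.bind Move.ofNat

open Classical in
/-- The probability that `T`, with oracle `O` and started in configuration `c`, halts within `k` steps
with output `y`. Coin flips and oracle answers are independent of each other. -/
def haltProb {S : Type*} [Primcodable S] (O : Oracle S) (T : Machine) (y : List S) :
    ℕ → ℕ → ℝ≥0∞
  | 0, _ => 0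
  | k + 1, c =>
    match (T.step c : Option (Move S)) with
    | none => 0
    | some (.halt z) => if z = y then 1 else 0
    | some (.next c') => haltProb O T y k c'
    | some (.flip c₀ c₁) => (haltProb O T y k c₀ + haltProb O T y k c₁) / 2
    | some (.query T' x p α c₁ c₀) =>
        ENNReal.ofReal (O T' x p α) * haltProb O T y k c₁
          + ENNReal.ofReal (1 - O T' x p α) * haltProb O T y k c₀

/-- The probability that `T`, with oracle `O`, outputs the string `y` on input `x`. -/
def outProb {S : Type*} [Primcodable S] (O : Oracle S) (T : Machine) (x y : List S) : ℝ :=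
  (⨆ k : ℕ, haltProb O T y k (Encodable.encode x)).toReal

/-- `λ_T^O(α | x)`: the probability that `T`, with oracle `O`, outputs on input `x` the symbol `α` and
nothing else. -/
def lam {S : Type*} [Primcodable S] (O : Oracle S) (T : Machine) (x : List S) (α : S) : ℝ :=
  outProb O T x [α]

/-! ## Typed reflective oracles over the alphabet `A ⊔ E` -/

section Reflective

variable {A E : Type*} [Fintype A] [Fintype E] [Primcodable A] [Primcodable E]

open Classical in
/-- The family `q` completes `λ_T^O(· | x)` to a probability vector on `A` and one on `E`, and `O`
answers the queries about `(T, x)` in accordance with `q`. -/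
structure IsCompletion (O : Oracle (A ⊕ E)) (T : Machine) (x : List (A ⊕ E)) (q : A ⊕ E → ℝ) :
    Prop where
  sum_inl : ∑ a, q (.inl a) = 1
  sum_inr : ∑ e, q (.inr e) = 1
  lower : ∀ α, lam O T x α ≤ q α
  upper_inl : ∀ a, q (.inl a) ≤ 1 - ∑ b ∈ Finset.univ.erase a, lam O T x (.inl b)
  upper_inr : ∀ e, q (.inr e) ≤ 1 - ∑ f ∈ Finset.univ.erase e, lam O T x (.inr f)
  yes : ∀ α (p : ℚ), (p : ℝ) < q α → O T x p α = 1
  no : ∀ α (p : ℚ), q α < (p : ℝ) → O T x p α = 0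

/-- Typed reflective oracles. -/
def IsReflective (O : Oracle (A ⊕ E)) : Prop :=
  ∀ (T : Machine) (x : List (A ⊕ E)), ∃ q, IsCompletion O T x q

theorem IsCompletion.unique {O : Oracle (A ⊕ E)} {T : Machine} {x : List (A ⊕ E)}
    {q q' : A ⊕ E → ℝ} (h : IsCompletion O T x q) (h' : IsCompletion O T x q') : q = q' := by
  have key : ∀ {q q' : A ⊕ E → ℝ}, IsCompletion O T x q → IsCompletion O T x q' →
      ∀ α, q α ≤ q' α := by
    intro q q' h h' α
    by_contra hlt
    obtain ⟨p, hp, hp'⟩ := exists_rat_btwn (not_le.mp hlt)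
    have := (h.yes α p hp').symm.trans (h'.no α p hp)
    exact one_ne_zero this
  exact funext fun α => le_antisymm (key h h' α) (key h' h α)

/-- The completion `\bar λ_T^O(· | x)` of `λ_T^O(· | x)` by the reflective oracle `O`; it is uniquely
determined. -/
def completion {O : Oracle (A ⊕ E)} (hO : IsReflective O) (T : Machine) (x : List (A ⊕ E)) :
    A ⊕ E → ℝ :=
  (hO T x).choose

end Reflective

/-! ## Policies, environments, values -/

section SingleAgent

variable {A E : Type*} [Fintype A] [Fintype E]

/-- Policies (strategies) `(A × E)^* → Δ A`. -/
abbrev Policy (A E : Type*) [Fintype A] : Type _ := List (A × E) → stdSimplex ℝ A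

/-- Environments, through their conditional probabilities: `ν h a e` is `ν(e | h a)`. -/
abbrev Environment (A E : Type*) : Type _ := List (A × E) → A → E → ℝ

/-- The probability of seeing the history `h` continued by the interactions `w`, given `h`, when `π`
interacts with `ν`. -/
def contProb (ν : Environment A E) (π : Policy A E) (h w : List (A × E)) : ℝ :=
  ∏ j : Fin w.length,
    π (h ++ w.take j) (w.get j).1 * ν (h ++ w.take j) (w.get j).1 (w.get j).2

/-- `Γ_t = ∑_{k ≥ t} γ_k`. -/
def discountNorm (γ : ℕ → ℝ) (t : ℕ) : ℝ := ∑' k, γ (t + k)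

/-- Expected discounted reward sum over the `m` steps that follow the history `h`. The step after `h`
has number `t = |h| + 1`, so these are the steps `t, …, t + m - 1`. -/
def rewardSum (r : E → ℝ) (γ : ℕ → ℝ) (ν : Environment A E) (π : Policy A E) (h : List (A × E))
    (m : ℕ) : ℝ :=
  ∑ w : Fin m → A × E,
    (∑ j : Fin m, γ (h.length + 1 + j) * r (w j).2) * contProb ν π h (List.ofFn w)

/-- The value `V_ν^π(h)`. -/
def value (r : E → ℝ) (γ : ℕ → ℝ) (ν : Environment A E) (π : Policy A E) (h : List (A × E)) : ℝ :=
  1 / discountNorm γ (h.length + 1) * limUnder atTop (rewardSum r γ ν π h)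

/-- The optimal value `V_ν^*(h)`. -/
def optValue (r : E → ℝ) (γ : ℕ → ℝ) (ν : Environment A E) (h : List (A × E)) : ℝ :=
  ⨆ π : Policy A E, value r γ ν π h

/-- Asymptotic optimality in mean of `π` in the class `M`: the expectation of `V_μ^* - V_μ^π` at the
history of the first `t` interactions of `π` with `μ` tends to 0, for each `μ ∈ M`. -/
def IsAsymptoticallyOptimal (r : E → ℝ) (γ : ℕ → ℝ) (M : Set (Environment A E))
    (π : Policy A E) : Prop :=
  ∀ μ ∈ M, Tendsto
    (fun t : ℕ => ∑ w : Fin t → A × E, contProb μ π [] (List.ofFn w) *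
      (optValue r γ μ (List.ofFn w) - value r γ μ π (List.ofFn w)))
    atTop (𝓝 0)

/-- The string `a_1 e_1 … a_t e_t` of a history. -/
def encHist (h : List (A × E)) : List (A ⊕ E) :=
  h.flatMap fun z => [.inl z.1, .inr z.2]

variable [Primcodable A] [Primcodable E]

/-- Reflective-oracle computable policies. -/
def IsROCPolicy (O : Oracle (A ⊕ E)) (π : Policy A E) : Prop :=
  ∃ T : Machine, ∀ h a, π h a = lam O T (encHist h) (.inl a)

/-- The class of the environments `\bar λ_T^O`. -/
def reflEnvironments {O : Oracle (A ⊕ E)} (hO : IsReflective O) : Set (Environment A E) :=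
  {ν | ∃ T : Machine, ∀ h a e, ν h a e = completion hO T (encHist h ++ [.inl a]) (.inr e)}

end SingleAgent

/-! ## Multi-player games -/

section MultiAgent

variable {n : ℕ} {A E : Type*} [Fintype A] [Fintype E]

/-- Joint histories: sequences of action vectors and percept vectors. -/
abbrev JointHistory (n : ℕ) (A E : Type*) : Type _ := List ((Fin n → A) × (Fin n → E))

/-- Multi-player games `(A^n × E^n)^* × A^n → Δ (E^n)`. -/
abbrev Game (n : ℕ) (A E : Type*) [Fintype E] : Type _ :=
  JointHistory n A E → (Fin n → A) → stdSimplex ℝ (Fin n → E)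

/-- What player `i` sees of a joint history. -/
def view (i : Fin n) (H : JointHistory n A E) : List (A × E) :=
  H.map fun z => (z.1 i, z.2 i)

/-- `σ^π(H)`: the probability that the first `|H|` interactions are `H`. -/
def gameProb (σ : Game n A E) (π : Fin n → Policy A E) (H : JointHistory n A E) : ℝ :=
  ∏ s : Fin H.length,
    (∏ j, π j (view j (H.take s)) ((H.get s).1 j)) * σ (H.take s) (H.get s).1 (H.get s).2

/-- `σ^π(H)` without the factors of the policy of player `i`. -/
def othersProb (σ : Game n A E) (π : Fin n → Policy A E) (i : Fin n) (H : JointHistory n A E) : ℝ :=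
  ∏ s : Fin H.length,
    (∏ j ∈ Finset.univ.erase i, π j (view j (H.take s)) ((H.get s).1 j)) *
      σ (H.take s) (H.get s).1 (H.get s).2

open Classical in
/-- The subjective environment `σ_i` of player `i`. The conditional probability
`σ_i^π(e | h a) = σ_i^π(h a e) / σ_i^π(h a)` of the marginal `σ_i^π` of `σ^π` does not depend on
`π_i`: the factors of `π_i` are the same in all terms of the two sums and cancel. They are
left out here, so that `σ_i(e | h a)` is also defined where `π_i` never takes the action `a`. The
value is the junk value 0 only where the denominator vanishes, that is, where `h` cannot occur
whatever player `i` does. -/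
def subjectiveEnv (σ : Game n A E) (π : Fin n → Policy A E) (i : Fin n) : Environment A E :=
  fun h a e =>
    (∑ w : Fin (h.length + 1) → (Fin n → A) × (Fin n → E),
        if view i (List.ofFn w) = h ++ [(a, e)] then othersProb σ π i (List.ofFn w) else 0) /
      ∑ w : Fin h.length → (Fin n → A) × (Fin n → E), ∑ b : Fin n → A,
        if view i (List.ofFn w) = h ∧ b i = a then
          othersProb σ π i (List.ofFn w) *
            ∏ j ∈ Finset.univ.erase i, π j (view j (List.ofFn w)) (b j)
        else 0

/-- After the joint history `H`, the policy of player `i` is an `ε`-best response. -/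
def IsBestResponseAt (r : E → ℝ) (γ : ℕ → ℝ) (σ : Game n A E) (π : Fin n → Policy A E) (i : Fin n)
    (ε : ℝ) (H : JointHistory n A E) : Prop :=
  optValue r γ (subjectiveEnv σ π i) (view i H)
    - value r γ (subjectiveEnv σ π i) (π i) (view i H) < ε

open Classical in
/-- The `σ^π`-probability that the first `t` interactions satisfy `P`. -/
def gameProbThat (σ : Game n A E) (π : Fin n → Policy A E) (t : ℕ) (P : JointHistory n A E → Prop) :
    ℝ :=
  ∑ w : Fin t → (Fin n → A) × (Fin n → E),
    if P (List.ofFn w) then gameProb σ π (List.ofFn w) else 0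

variable [Primcodable A] [Primcodable E]

/-- The string of a joint history followed by an action vector: an action vector is written as its `n`
actions, a percept vector as its `n` percepts. -/
def encGameInput (H : JointHistory n A E) (b : Fin n → A) : List (A ⊕ E) :=
  (H.flatMap fun z => (List.ofFn fun j => .inl (z.1 j)) ++ (List.ofFn fun j => .inr (z.2 j)))
    ++ List.ofFn fun j => .inl (b j)

/-- Reflective-oracle computable games: some machine outputs percept vectors, written as strings of
`n` percepts, with the probabilities of the game. -/
def IsROCGame (O : Oracle (A ⊕ E)) (σ : Game n A E) : Prop :=
  ∃ T : Machine, ∀ H b e,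
    σ H b e = outProb O T (encGameInput H b) (List.ofFn fun j => .inr (e j))

end MultiAgent

end

end ReflGame

/-! The core is that each subjective environment $\sigma_i$ agrees, on every history of player $i$
that can occur, with a member $\mu$ of the reflective class. Asymptotic optimality in $\mu$ then
says that the expected optimality gap of $\pi_i$ tends to 0, and Markov's inequality turns this into
convergence in probability.

To find $\mu$, a machine samples from $\sigma_i(\cdot\mid ha)$ by rejection
(`exists_subjectiveMachine`): it simulates the game with the machines of the game and of the other
players, copies player $i$'s actions from the input, and starts afresh as soon as a percept of
player $i$ contradicts the input. Only lower bounds on its output probabilities are proved: they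
give $\lambda(e\mid ha)\ge\sigma_i(e\mid ha)$ for possible $h$. The completion $\bar\lambda$
dominates $\lambda$, and both $\bar\lambda$ and $\sigma_i$ sum to 1 over percepts, so they are equal
(`exists_reflEnvironment_agree`).

The lower bound needs neither almost sure termination nor a geometric series. With $G(L)$ the
probability of eventually outputting $e$ from the partial simulation $L$, a restart contributes
nothing to the expectation of $G(L)-G([\,])$. Hence this expectation, restricted to simulations that
follow a prefix of $h$, starts at 0 and cannot increase as the prefix grows.

Impossible histories have probability zero under both environments, and a possible history has only
possible continuations of positive probability. So values and optimal values at possible histories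
are the same in $\sigma_i$ and $\mu$ (`contProb_congr_of_agree`). -/

namespace ReflGame

noncomputable section

/-! ## Halting probabilities -/

section Halting

variable {S : Type*} [Primcodable S] (O : Oracle S) (T : Machine) (y : List S)

/-- The probability that `T`, with oracle `O` and started in configuration `c`, outputs `y`. -/
def reachProb (c : ℕ) : ℝ≥0∞ := ⨆ k : ℕ, haltProb O T y k c

variable {T}

open Classical in
theorem haltProb_halt {c : ℕ} {z : List S} (h : T.step c = some (.halt z)) (k : ℕ) :
    haltProb O T y (k + 1) c = if z = y then 1 else 0 := by
  simp [haltProb, h]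

theorem haltProb_next {c c' : ℕ} (h : (T.step c : Option (Move S)) = some (.next c')) (k : ℕ) :
    haltProb O T y (k + 1) c = haltProb O T y k c' := by
  simp [haltProb, h]

theorem haltProb_flip {c c₀ c₁ : ℕ} (h : (T.step c : Option (Move S)) = some (.flip c₀ c₁))
    (k : ℕ) :
    haltProb O T y (k + 1) c = (haltProb O T y k c₀ + haltProb O T y k c₁) / 2 := by
  simp [haltProb, h]

theorem haltProb_query {c c₀ c₁ : ℕ} {T' : Machine} {x : List S} {p : ℚ} {α : S}
    (h : (T.step c : Option (Move S)) = some (.query T' x p α c₁ c₀)) (k : ℕ) :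
    haltProb O T y (k + 1) c = ENNReal.ofReal (O T' x p α) * haltProb O T y k c₁
      + ENNReal.ofReal (1 - O T' x p α) * haltProb O T y k c₀ := by
  simp [haltProb, h]

theorem haltProb_none {c : ℕ} (h : (T.step c : Option (Move S)) = none) (k : ℕ) :
    haltProb O T y (k + 1) c = 0 := by
  simp [haltProb, h]

theorem haltProb_le_succ (k c : ℕ) : haltProb O T y k c ≤ haltProb O T y (k + 1) c := by
  induction k generalizing c with
  | zero => simp [haltProb]
  | succ k ih =>
    rcases h : (T.step c : Option (Move S)) with _ | (z | c' | ⟨c₀, c₁⟩ | ⟨T', x, p, α, c₁, c₀⟩)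
    · simp [haltProb_none O y h]
    · simp [haltProb_halt O y h]
    · simpa [haltProb_next O y h] using ih c'
    · rw [haltProb_flip O y h, haltProb_flip O y h]
      gcongr <;> apply ih
    · rw [haltProb_query O y h, haltProb_query O y h]
      gcongr <;> apply ih

theorem haltProb_mono (c : ℕ) : Monotone fun k => haltProb O T y k c :=
  monotone_nat_of_le_succ fun k => haltProb_le_succ O y k c

theorem ofReal_add_ofReal_one_sub (p : unitInterval) :
    ENNReal.ofReal p + ENNReal.ofReal (1 - p) = 1 := by
  rw [← ENNReal.ofReal_add p.2.1 (sub_nonneg.mpr p.2.2)]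
  simp

theorem haltProb_le_one (k c : ℕ) : haltProb O T y k c ≤ 1 := by
  induction k generalizing c with
  | zero => simp [haltProb]
  | succ k ih =>
    rcases h : (T.step c : Option (Move S)) with _ | (z | c' | ⟨c₀, c₁⟩ | ⟨T', x, p, α, c₁, c₀⟩)
    · simp [haltProb_none O y h]
    · rw [haltProb_halt O y h]
      split_ifs <;> simp
    · simpa [haltProb_next O y h] using ih c'
    · rw [haltProb_flip O y h]
      refine ENNReal.div_le_of_le_mul ?_
      calc _ ≤ (1 : ℝ≥0∞) + 1 := add_le_add (ih _) (ih _)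
        _ = _ := by rw [one_mul, one_add_one_eq_two]
    · rw [haltProb_query O y h, ← ofReal_add_ofReal_one_sub (O T' x p α)]
      gcongr <;> exact mul_le_of_le_one_right' (ih _)

theorem haltProb_le_reachProb (k c : ℕ) : haltProb O T y k c ≤ reachProb O T y c :=
  le_iSup (fun k => haltProb O T y k c) k

theorem reachProb_le_one (c : ℕ) : reachProb O T y c ≤ 1 :=
  iSup_le fun k => haltProb_le_one O y k c

theorem outProb_eq (x : List S) : outProb O T x y = (reachProb O T y (Encodable.encode x)).toReal :=
  rfl

theorem outProb_nonneg (x : List S) : 0 ≤ outProb O T x y := ENNReal.toReal_nonneg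

theorem one_le_reachProb_of_halt {c : ℕ} (h : T.step c = some (.halt y)) :
    1 ≤ reachProb O T y c := by
  classical
  simpa [haltProb_halt O y h] using haltProb_le_reachProb O (T := T) y 1 c

/-- Here and for flips and queries one inequality is enough, because every later estimate bounds
output probabilities from below. -/
theorem reachProb_next {c c' : ℕ} (h : (T.step c : Option (Move S)) = some (.next c')) :
    reachProb O T y c' ≤ reachProb O T y c :=
  iSup_le fun k => (haltProb_next O y h k).symm.trans_le (haltProb_le_reachProb O y _ _)

theorem reachProb_flip {c c₀ c₁ : ℕ} (h : (T.step c : Option (Move S)) = some (.flip c₀ c₁)) :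
    (reachProb O T y c₀ + reachProb O T y c₁) / 2 ≤ reachProb O T y c := by
  rw [reachProb, reachProb,
    ENNReal.iSup_add_iSup_of_monotone (haltProb_mono O y _) (haltProb_mono O y _),
    ENNReal.iSup_div]
  exact iSup_le fun k => (haltProb_flip O y h k).symm.trans_le (haltProb_le_reachProb O y _ _)

theorem reachProb_query {c c₀ c₁ : ℕ} {T' : Machine} {x : List S} {p : ℚ} {α : S}
    (h : (T.step c : Option (Move S)) = some (.query T' x p α c₁ c₀)) :
    ENNReal.ofReal (O T' x p α) * reachProb O T y c₁
      + ENNReal.ofReal (1 - O T' x p α) * reachProb O T y c₀ ≤ reachProb O T y c := by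
  rw [reachProb, reachProb, ENNReal.mul_iSup, ENNReal.mul_iSup,
    ENNReal.iSup_add_iSup_of_monotone]
  · exact iSup_le fun k => (haltProb_query O y h k).symm.trans_le (haltProb_le_reachProb O y _ _)
  · exact fun k l hkl => mul_le_mul_right (haltProb_mono O y _ hkl) _
  · exact fun k l hkl => mul_le_mul_right (haltProb_mono O y _ hkl) _

/-- Rename configurations by `g`, and go to configuration `f z` instead of halting with output `z`. -/
def Move.redirect (f : List S → ℕ) (g : ℕ → ℕ) : Move S → Move S
  | .halt z => .next (f z)
  | .next c => .next (g c)
  | .flip c₀ c₁ => .flip (g c₀) (g c₁)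
  | .query T' x p α c₁ c₀ => .query T' x p α (g c₁) (g c₀)

/-- A machine `T` that simulates `T'` as a subroutine. -/
theorem sum_haltProb_mul_le_reachProb {T T' : Machine} {f : List S → ℕ} {g : ℕ → ℕ}
    (hsim : ∀ c m, T'.step c = some m → T.step (g c) = some (m.redirect f g))
    (F : Finset (List S)) (k c : ℕ) :
    ∑ z ∈ F, haltProb O T' z k c * reachProb O T y (f z) ≤ reachProb O T y (g c) := by
  classical
  -- The step bound is only on `T'`. For `T` the limit is taken, so its extra step from a halt of
  -- `T'` to `f z` costs nothing.
  induction k generalizing c with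
  | zero => simp [haltProb]
  | succ k ih =>
    rcases h : (T'.step c : Option (Move S)) with
      _ | (z | c' | ⟨c₀, c₁⟩ | ⟨T'', x, p, α, c₁, c₀⟩)
    · simp [haltProb_none O _ h]
    · refine le_trans ?_ (reachProb_next O y (hsim c _ h))
      simp only [haltProb_halt O _ h, ite_mul, one_mul, zero_mul, Finset.sum_ite_eq]
      split_ifs <;> simp
    · refine le_trans ?_ (reachProb_next O y (hsim c _ h))
      simpa only [haltProb_next O _ h] using ih c'
    · refine le_trans ?_ (reachProb_flip O y (hsim c _ h))
      simp only [haltProb_flip O _ h, div_eq_mul_inv]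
      refine le_trans (le_of_eq ?_) (mul_le_mul_left (add_le_add (ih c₀) (ih c₁)) _)
      rw [← Finset.sum_add_distrib, Finset.sum_mul]
      exact Finset.sum_congr rfl fun z _ => by ring
    · refine le_trans ?_ (reachProb_query O y (hsim c _ h))
      simp only [haltProb_query O _ h]
      refine le_trans (le_of_eq ?_)
        (add_le_add (mul_le_mul_right (ih c₁) _) (mul_le_mul_right (ih c₀) _))
      rw [Finset.mul_sum, Finset.mul_sum, ← Finset.sum_add_distrib]
      exact Finset.sum_congr rfl fun z _ => by ring

/-- Monotone convergence in the step bound; the sum over outputs is kept finite so that it commutes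
with the supremum. -/
theorem sum_reachProb_mul_le_reachProb {T T' : Machine} {f : List S → ℕ} {g : ℕ → ℕ}
    (hsim : ∀ c m, T'.step c = some m → T.step (g c) = some (m.redirect f g))
    (F : Finset (List S)) (c : ℕ) :
    ∑ z ∈ F, reachProb O T' z c * reachProb O T y (f z) ≤ reachProb O T y (g c) := by
  simp only [reachProb.eq_1 O T', ENNReal.iSup_mul]
  rw [ENNReal.finsetSum_iSup_of_monotone]
  · exact iSup_le fun k => sum_haltProb_mul_le_reachProb O y hsim F k c
  · exact fun z k l hkl => mul_le_mul_left (haltProb_mono O z _ hkl) _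

end Halting

/-! ## Machines that call other machines -/

section Driver

variable {S : Type*}

/-- Moves as they are coded by natural numbers. -/
abbrev RawMove (S : Type*) : Type _ :=
  List S ⊕ ℕ ⊕ (ℕ × ℕ) ⊕ ((Machine × List S × (ℕ × ℕ) × S) × ℕ × ℕ)

/-- The move given by a raw move. -/
def RawMove.toMove : RawMove S → Move S
  | .inl y => .halt y
  | .inr (.inl c) => .next c
  | .inr (.inr (.inl (c₀, c₁))) => .flip c₀ c₁
  | .inr (.inr (.inr ((T, x, (k, d), α), c₁, c₀))) => .query T x ((k : ℚ) / (d + 1)) α c₁ c₀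

/-- The counterpart of `Move.redirect` on raw moves. -/
def RawMove.redirect (f : List S → ℕ) (g : ℕ → ℕ) : RawMove S → RawMove S
  | .inl z => .inr (.inl (f z))
  | .inr (.inl c) => .inr (.inl (g c))
  | .inr (.inr (.inl c)) => .inr (.inr (.inl (g c.1, g c.2)))
  | .inr (.inr (.inr q)) => .inr (.inr (.inr (q.1, g q.2.1, g q.2.2)))

theorem RawMove.toMove_redirect (f : List S → ℕ) (g : ℕ → ℕ) (m : RawMove S) :
    (m.redirect f g).toMove = m.toMove.redirect f g := by
  rcases m with z | c | c | q <;> rfl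

variable [Primcodable S]

theorem Move.ofNat_eq (m : ℕ) :
    Move.ofNat m = (Encodable.decode m : Option (RawMove S)).map RawMove.toMove :=
  rfl

theorem Move.ofNat_encode (m : RawMove S) : Move.ofNat (Encodable.encode m) = some m.toMove := by
  rw [Move.ofNat_eq, Encodable.encodek]
  rfl

theorem Machine.step_eq_some {T : Machine} {c : ℕ} {m : RawMove S}
    (h : Encodable.encode m ∈ Nat.Partrec.Code.eval T c) : T.step c = some m.toMove := by
  classical
  rw [Machine.step, Part.eq_some_iff.mpr h, ← Move.ofNat_encode]
  simp

theorem Machine.exists_rawMove {T : Machine} {c : ℕ} {m : Move S} (h : T.step c = some m) :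
    ∃ k ∈ Nat.Partrec.Code.eval T c, ∃ m' : RawMove S,
      Encodable.decode k = some m' ∧ m = m'.toMove := by
  classical
  rw [Machine.step, Option.bind_eq_some_iff] at h
  obtain ⟨k, hk, hm⟩ := h
  rw [Move.ofNat_eq, Option.map_eq_some_iff] at hm
  obtain ⟨m', hm', rfl⟩ := hm
  exact ⟨k, by simpa using hk, m', hm', rfl⟩

variable {D : Type*} [Primcodable D]

/-- States of a machine that calls other machines: its control state, and the machine that is being
called (if there is one) with its configuration. -/
abbrev CallState (D : Type*) : Type _ := D × Option (Machine × ℕ)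

/-- Configurations of a machine that calls other machines. The number `d` codes no symbol, so that such a
configuration is not the code of an input. -/
def callConfig (d : ℕ) (s : CallState D) : ℕ := Nat.succ (Nat.pair d (Encodable.encode s))

/-- The state of a machine that calls other machines, given its configuration. -/
def callState (d : ℕ) (init : List S → D) (c : ℕ) : Option (CallState D) :=
  bif c.pred.unpair.1 == d then Encodable.decode c.pred.unpair.2
  else (Encodable.decode c : Option (List S)).map fun x => (init x, none)

/-- The step of a machine that calls other machines. -/
def callStep (d : ℕ) (act : D → List S ⊕ (Machine × List S)) (ret : D → List S → D)
    (s : CallState D) : Part (RawMove S) :=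
  Sum.casesOn (motive := fun _ => Part (RawMove S))
    (Option.casesOn (motive := fun _ => RawMove S ⊕ (Machine × ℕ)) s.2
      (Sum.inl (Sum.casesOn (motive := fun _ => RawMove S) (act s.1) Sum.inl
        fun q => .inr (.inl (callConfig d (s.1, some (q.1, Encodable.encode q.2))))))
      Sum.inr)
    Part.some
    fun q => ((Nat.Partrec.Code.eval q.1 q.2).bind fun k =>
      ((Encodable.decode k : Option (RawMove S)) : Part (RawMove S))).map
        (RawMove.redirect (fun z => callConfig d (ret s.1 z, none))
          fun c => callConfig d (s.1, some (q.1, c)))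

theorem computable_callConfig (d : ℕ) : Computable (callConfig d : CallState D → ℕ) :=
  (Primrec.succ.comp (Primrec₂.natPair.comp (Primrec.const d) Primrec.encode)).to_comp

theorem computable_callState (d : ℕ) {init : List S → D} (hinit : Computable init) :
    Computable (callState d init) := by
  have h : Computable fun c : ℕ => c.pred.unpair :=
    (Primrec.unpair.comp Primrec.pred).to_comp
  refine Computable.cond
    ((Primrec.beq.comp (Primrec.fst.comp (Primrec.unpair.comp Primrec.pred))
      (Primrec.const d)).to_comp) ?_ ?_
  · exact Computable.decode.comp (Computable.snd.comp h)
  · exact Computable.option_map Computable.decode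
      (((hinit.comp Computable.snd).pair (Computable.const none)).to₂)

theorem computable_redirect {X : Type*} [Primcodable X] {f : X → List S → ℕ} {g : X → ℕ → ℕ}
    {m : X → RawMove S} (hf : Computable₂ f) (hg : Computable₂ g) (hm : Computable m) :
    Computable fun x => RawMove.redirect (f x) (g x) (m x) := by
  have : Computable fun x => (Sum.casesOn (motive := fun _ => RawMove S) (m x)
      (fun z => .inr (.inl (f x z))) fun m =>
      Sum.casesOn (motive := fun _ => RawMove S) m (fun c => .inr (.inl (g x c))) fun m =>
      Sum.casesOn (motive := fun _ => RawMove S) m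
        (fun c => .inr (.inr (.inl (g x c.1, g x c.2))))
        fun q => .inr (.inr (.inr (q.1, g x q.2.1, g x q.2.2))) : RawMove S) := by
    refine Computable.sumCasesOn hm
      (Computable.sumInr.comp (Computable.sumInl.comp hf)).to₂ ?_
    refine Computable.sumCasesOn Computable.snd
      (Computable.sumInr.comp (Computable.sumInl.comp
        (hg.comp (Computable.fst.comp Computable.fst) Computable.snd))).to₂ ?_
    have hx : Computable fun a : ((X × (ℕ ⊕ (ℕ × ℕ) ⊕ ((Machine × List S × (ℕ × ℕ) × S) × ℕ × ℕ)))
        × ((ℕ × ℕ) ⊕ ((Machine × List S × (ℕ × ℕ) × S) × ℕ × ℕ))) => a.1.1 :=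
      Computable.fst.comp Computable.fst
    refine Computable.sumCasesOn Computable.snd ?_ ?_
    · exact (Computable.sumInr.comp (Computable.sumInr.comp (Computable.sumInl.comp
        ((hg.comp (hx.comp Computable.fst) (Computable.fst.comp Computable.snd)).pair
          (hg.comp (hx.comp Computable.fst) (Computable.snd.comp Computable.snd)))))).to₂
    · exact (Computable.sumInr.comp (Computable.sumInr.comp (Computable.sumInr.comp
        ((Computable.fst.comp Computable.snd).pair
        ((hg.comp (hx.comp Computable.fst)
            (Computable.fst.comp (Computable.snd.comp Computable.snd))).pair
          (hg.comp (hx.comp Computable.fst)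
            (Computable.snd.comp (Computable.snd.comp Computable.snd)))))))).to₂
  refine this.of_eq fun x => ?_
  rcases m x with z | c | c | q <;> rfl

/-- The called machine is part of the state, so it is run by the universal partial recursive
function `Nat.Partrec.Code.eval`. -/
theorem partrec_callStep (d : ℕ) {act : D → List S ⊕ (Machine × List S)} {ret : D → List S → D}
    (hact : Computable act) (hret : Computable₂ ret) : Partrec (callStep d act ret) := by
  refine Partrec.sumCasesOn_right ?_ Computable.snd.to₂ ?_
  · refine Computable.option_casesOn Computable.snd (Computable.sumInl.comp ?_)
      (Computable.sumInr.comp Computable.snd).to₂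
    refine Computable.sumCasesOn (hact.comp Computable.fst)
      (Computable.sumInl.comp Computable.snd).to₂ ?_
    exact (Computable.sumInr.comp (Computable.sumInl.comp ((computable_callConfig d).comp
      ((Computable.fst.comp Computable.fst).pair (Computable.option_some.comp
        ((Computable.fst.comp Computable.snd).pair
          (Computable.encode.comp (Computable.snd.comp Computable.snd)))))))).to₂
  · refine Partrec.map ?_ ?_
    · refine Partrec.bind (Nat.Partrec.Code.eval_part.comp (Computable.fst.comp Computable.snd)
        (Computable.snd.comp Computable.snd)) ?_
      exact (Computable.ofOption (Computable.decode.comp Computable.snd)).to₂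
    · have hs : Computable fun q : ((CallState D × (Machine × ℕ)) × RawMove S) × List S =>
          q.1.1.1.1 :=
        Computable.fst.comp (Computable.fst.comp (Computable.fst.comp Computable.fst))
      have hs' : Computable fun q : ((CallState D × (Machine × ℕ)) × RawMove S) × ℕ =>
          q.1.1.1.1 :=
        Computable.fst.comp (Computable.fst.comp (Computable.fst.comp Computable.fst))
      have hq : Computable fun q : ((CallState D × (Machine × ℕ)) × RawMove S) × ℕ =>
          q.1.1.2.1 :=
        Computable.fst.comp (Computable.snd.comp (Computable.fst.comp Computable.fst))
      have hf : Computable₂ fun (q : (CallState D × (Machine × ℕ)) × RawMove S) (z : List S) =>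
          callConfig d ((ret q.1.1.1 z, none) : CallState D) :=
        ((computable_callConfig d).comp
          ((hret.comp hs Computable.snd).pair (Computable.const none))).to₂
      have hg : Computable₂ fun (q : (CallState D × (Machine × ℕ)) × RawMove S) (c : ℕ) =>
          callConfig d ((q.1.1.1, some (q.1.2.1, c)) : CallState D) :=
        ((computable_callConfig d).comp (hs'.pair
          (Computable.option_some.comp (hq.pair Computable.snd)))).to₂
      exact (computable_redirect hf hg Computable.snd).to₂

/-- For every computable control with states in `D` there is a machine that starts in the control state
`init x` and, in the control state `δ`, either halts with an output string or calls some machine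
on some input and goes to the control state `ret δ z` when this machine outputs `z`, as specified by
`act δ`. Here `W y δ` is the probability that the machine outputs `y` from the control state `δ`. -/
theorem exists_callingMachine [Finite S] (O : Oracle S) {init : List S → D}
    {act : D → List S ⊕ (Machine × List S)} {ret : D → List S → D}
    (hinit : Computable init) (hact : Computable act) (hret : Computable₂ ret) :
    ∃ (T : Machine) (W : List S → D → ℝ),
      (∀ y δ, 0 ≤ W y δ) ∧
      (∀ x y, W y (init x) ≤ outProb O T x y) ∧
      (∀ y δ, act δ = .inl y → 1 ≤ W y δ) ∧
      ∀ y δ T' x', act δ = .inr (T', x') → ∀ F : Finset (List S),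
        ∑ z ∈ F, outProb O T' x' z * W y (ret δ z) ≤ W y δ := by
  -- After `pred` and `unpair`, the code of an input has first component 0 if the input is empty,
  -- and the code of its first symbol otherwise. A number `d` distinct from all of these marks
  -- internal configurations.
  obtain ⟨d, hd⟩ : ∃ d, d ∉ insert 0 (Set.range (Encodable.encode : S → ℕ)) :=
    ((Set.finite_range _).insert 0).exists_notMem
  have hstep : Partrec fun c : ℕ => ((callState d init c : Option (CallState D)) :
      Part (CallState D)).bind fun s => (callStep d act ret s).map Encodable.encode :=
    (Computable.ofOption (computable_callState d hinit)).bind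
      (((partrec_callStep d hact hret).map (Computable.encode.comp Computable.snd).to₂).comp
        Computable.snd).to₂
  obtain ⟨T, hT⟩ := Nat.Partrec.Code.exists_code.mp (Partrec.nat_iff.mp hstep)
  have hdec (s : CallState D) : callState d init (callConfig d s) = some s := by
    simp [callState, callConfig]
  have hTstep {c : ℕ} {s : CallState D} {m : RawMove S} (hc : callState d init c = some s)
      (hm : m ∈ callStep d act ret s) : Machine.step T c = some m.toMove := by
    refine Machine.step_eq_some ?_
    simp only [hT, hc]
    simpa using hm
  have hmem (δ : D) : (Sum.casesOn (motive := fun _ => RawMove S) (act δ) Sum.inl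
      fun q => .inr (.inl (callConfig d (δ, some (q.1, Encodable.encode q.2)))) : RawMove S) ∈
        callStep d act ret (δ, none) := Part.mem_some _
  have hsim (δ : D) (T' : Machine) (c : ℕ) (m : Move S) (hm : T'.step c = some m) :
      Machine.step T (callConfig d (δ, some (T', c))) = some (m.redirect
        (fun z => callConfig d (ret δ z, none)) fun c => callConfig d (δ, some (T', c))) := by
    obtain ⟨k, hk, m', hm', rfl⟩ := Machine.exists_rawMove hm
    rw [← RawMove.toMove_redirect]
    refine hTstep (hdec (δ, some (T', c))) (Part.mem_map _ (Part.mem_bind_iff.mpr ⟨k, hk, ?_⟩))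
    rw [hm']
    exact Part.mem_some _
  have hfin (T : Machine) (y : List S) (c : ℕ) : reachProb O T y c ≠ ⊤ :=
    ((reachProb_le_one O y c).trans_lt ENNReal.one_lt_top).ne
  refine ⟨T, fun y δ => (reachProb O T y (callConfig d (δ, none))).toReal,
    fun y δ => ENNReal.toReal_nonneg, fun x y => ?_, fun y δ h => ?_,
    fun y δ T' x' h F => ?_⟩
  · rw [outProb_eq]
    refine ENNReal.toReal_mono (hfin _ _ _) ?_
    have hx : callState d init (Encodable.encode x) = some (init x, none) := by
      have : ((Encodable.encode x).pred.unpair.1 == d) = false := by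
        rw [beq_eq_false_iff_ne]
        rintro rfl
        refine hd ?_
        rcases x with _ | ⟨a, l⟩
        · exact Or.inl (by simp)
        · exact Or.inr ⟨a, by simp⟩
      rw [callState, this, Encodable.encodek]
      rfl
    have h₁ := hTstep hx (hmem (init x))
    have h₂ := hTstep (hdec (init x, none)) (hmem (init x))
    -- The input `x` and the internal configuration of `init x` make the same first move, so they
    -- have equal halting probabilities for every step bound.
    refine iSup_mono fun k => ?_
    rcases k with _ | k
    · simp [haltProb]
    · rw [haltProb, haltProb, h₁, h₂]
  · rw [← ENNReal.toReal_one]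
    refine ENNReal.toReal_mono (hfin _ _ _) (one_le_reachProb_of_halt O y ?_)
    have := hTstep (hdec (δ, none)) (hmem δ)
    rwa [h] at this
  · have := hTstep (hdec (δ, none)) (hmem δ)
    rw [h] at this
    simp only [outProb_eq, ← ENNReal.toReal_mul]
    rw [← ENNReal.toReal_sum fun z _ => ENNReal.mul_ne_top (hfin _ _ _) (hfin _ _ _)]
    refine ENNReal.toReal_mono (hfin _ _ _) (le_trans ?_ (reachProb_next O y this))
    exact sum_reachProb_mul_le_reachProb O y
      (g := fun c => callConfig d (δ, some (T', c))) (hsim δ T') F _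

/-- A machine that outputs its input. -/
theorem exists_echoMachine (O : Oracle S) : ∃ T : Machine, ∀ x, outProb O T x x = 1 := by
  have h : Partrec fun c : ℕ => ((Encodable.decode c : Option (List S)) : Part (List S)).map
      fun x => Encodable.encode (Sum.inl x : RawMove S) :=
    (Computable.ofOption Computable.decode).map
      (Computable.encode.comp (Computable.sumInl.comp Computable.snd)).to₂
  obtain ⟨T, hT⟩ := Nat.Partrec.Code.exists_code.mp (Partrec.nat_iff.mp h)
  refine ⟨T, fun x => ?_⟩
  have : Machine.step T (Encodable.encode x) = some (.halt x) :=
    Machine.step_eq_some (m := Sum.inl x) (by rw [hT]; simp)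
  rw [outProb_eq, le_antisymm (reachProb_le_one O x _) (one_le_reachProb_of_halt O x this)]
  rfl

end Driver

/-! ## Strings of histories -/

section Strings

variable {S : Type*}

/-- The symbols of `L` at the positions that are congruent to `j` modulo `n`. -/
def pick (n j : ℕ) (L : List S) : List S :=
  (List.range L.length).filterMap fun k => if k % n = j then L[k]? else none

theorem pick_append {n : ℕ} (j : ℕ) {L₁ : List S} (h : n ∣ L₁.length) (L₂ : List S) :
    pick n j (L₁ ++ L₂) = pick n j L₁ ++ pick n j L₂ := by
  rw [pick, List.length_append, List.range_add, List.filterMap_append, List.filterMap_map]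
  congr 1
  · refine List.filterMap_congr fun k hk => ?_
    rw [List.getElem?_append_left (List.mem_range.mp hk)]
  · refine List.filterMap_congr fun k _ => ?_
    obtain ⟨c, hc⟩ := h
    simp [hc, List.getElem?_append_right]

theorem pick_of_length_le {n : ℕ} (j : ℕ) {L : List S} (h : L.length ≤ n) :
    pick n j L = L[j]?.toList := by
  have key (m : ℕ) (f : ℕ → Option S) :
      ((List.range m).filterMap fun k => if k = j then f k else none) =
        if j < m then (f j).toList else [] := by
    induction m with
    | zero => simp
    | succ m ih =>
      rw [List.range_succ, List.filterMap_append, ih]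
      rcases lt_trichotomy j m with hj | rfl | hj
      · simp [hj, hj.ne', Nat.lt_succ_of_lt hj]
      · cases hf : f j <;> simp [hf]
      · simp [hj.not_gt, hj.ne, show ¬ j < m + 1 by omega]
  rw [pick, List.filterMap_congr (g := fun k => if k = j then L[k]? else none), key]
  · split_ifs with hj
    · rfl
    · rw [List.getElem?_eq_none (not_lt.mp hj)]
      rfl
  · intro k hk
    rw [Nat.mod_eq_of_lt ((List.mem_range.mp hk).trans_le h)]

theorem pick_ofFn {n : ℕ} (j : Fin n) (f : Fin n → S) : pick n j (List.ofFn f) = [f j] := by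
  rw [pick_of_length_le _ (by simp)]
  simp

theorem primrec_pick [Primcodable S] (n : ℕ) : Primrec₂ fun (j : ℕ) (L : List S) => pick n j L := by
  refine Primrec.listFilterMap
    (Primrec.list_range.comp (Primrec.list_length.comp Primrec.snd)) ?_
  refine Primrec.ite (Primrec.eq.comp (Primrec.nat_mod.comp Primrec.snd (Primrec.const n))
    (Primrec.fst.comp Primrec.fst)) ?_ (Primrec.const none)
  exact Primrec.list_getElem?.comp (Primrec.snd.comp Primrec.fst) Primrec.snd

variable {n : ℕ} {A E : Type*}

/-- The string of a joint history. -/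
def encJoint (H : JointHistory n A E) : List (A ⊕ E) :=
  H.flatMap fun z => (List.ofFn fun j => .inl (z.1 j)) ++ List.ofFn fun j => .inr (z.2 j)

theorem encJoint_concat (H : JointHistory n A E) (z : (Fin n → A) × (Fin n → E)) :
    encJoint (H ++ [z]) =
      encGameInput H z.1 ++ List.ofFn fun j => (.inr (z.2 j) : A ⊕ E) := by
  simp [encJoint, encGameInput]

theorem encGameInput_eq (H : JointHistory n A E) (b : Fin n → A) :
    encGameInput H b = encJoint H ++ List.ofFn fun j => .inl (b j) := rfl

theorem length_encJoint (H : JointHistory n A E) : (encJoint H).length = 2 * n * H.length := by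
  induction H with
  | nil => simp [encJoint]
  | cons z H ih =>
    simp only [encJoint, List.flatMap_cons, List.length_append, List.length_ofFn,
      List.length_cons] at ih ⊢
    rw [ih]
    ring

theorem encHist_append (h₁ h₂ : List (A × E)) : encHist (h₁ ++ h₂) = encHist h₁ ++ encHist h₂ := by
  simp [encHist]

theorem encHist_concat (h : List (A × E)) (z : A × E) :
    encHist (h ++ [z]) = encHist h ++ [.inl z.1, .inr z.2] := by
  simp [encHist]

theorem view_concat (i : Fin n) (H : JointHistory n A E) (z : (Fin n → A) × (Fin n → E)) :
    view i (H ++ [z]) = view i H ++ [(z.1 i, z.2 i)] := by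
  simp [view]

/-- A round is a block of `n` actions followed by a block of `n` percepts, and player `j` owns
position `j` of both. -/
theorem pick_encJoint (j : Fin n) (H : JointHistory n A E) :
    pick n j (encJoint H) = encHist (view j H) := by
  induction H with
  | nil => rfl
  | cons z H ih =>
    have h : encJoint (z :: H) = (List.ofFn fun j => .inl (z.1 j)) ++
      ((List.ofFn fun j => .inr (z.2 j)) ++ encJoint H) := by simp [encJoint]
    rw [h, pick_append _ (by simp), pick_append _ (by simp), pick_ofFn, pick_ofFn, ih]
    rfl

theorem pick_encJoint_append (j : Fin n) (H : JointHistory n A E) (L : List (A ⊕ E)) :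
    pick n j (encJoint H ++ L) = encHist (view j H) ++ pick n j L := by
  rw [pick_append _ ⟨2 * H.length, by rw [length_encJoint]; ring⟩, pick_encJoint]

end Strings

/-! ## Rejection sampling -/

section Sampling

variable {S : Type*} {n : ℕ}

open Classical in
/-- The control of the machine that samples from a subjective environment. A state consists of the input
`x` (a history of player `i` and an action) and the string `L` of a joint history that agrees with `x`.
The other players' actions and the percepts are sampled by the machines `T j` and `T'`, and the actions
of player `i` are copied from `x`. -/
def sampleAct (i : Fin n) (T : Fin n → Machine) (T' T₀ : Machine) (s : List S × List S) :
    List S ⊕ (Machine × List S) :=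
  if s.1.length < (pick n i s.2).length then .inl ((pick n i s.2).drop s.1.length)
  else .inr <|
    -- The residue modulo `2 * n` tells what is sampled next: a residue `m < n` stands for the
    -- action of player `m`, residue `n` for the whole percept vector. In the latter case the index
    -- is out of range and `getD` selects `T'`.
    if s.2.length % (2 * n) = i then (T₀, s.1[(pick n i s.2).length]?.toList)
    else ((List.ofFn T)[s.2.length % (2 * n)]?.getD T',
      if s.2.length % (2 * n) < n then pick n (s.2.length % (2 * n)) s.2 else s.2)

open Classical in
/-- Keep the string `L` if player `i`'s part of it agrees with `x`, and start again otherwise. -/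
def reject (i : Fin n) (x L : List S) : List S :=
  if (pick n i L).take x.length = x.take (pick n i L).length then L else []

theorem computable_sampleAct [Primcodable S] (i : Fin n) (T : Fin n → Machine) (T' T₀ : Machine) :
    Computable (sampleAct i T T' T₀ : List S × List S → _) := by
  have hv : Primrec fun s : List S × List S => pick n i s.2 :=
    (primrec_pick n).comp (Primrec.const (i : ℕ)) Primrec.snd
  have hm : Primrec fun s : List S × List S => s.2.length % (2 * n) :=
    Primrec.nat_mod.comp (Primrec.list_length.comp Primrec.snd) (Primrec.const _)
  refine Primrec.to_comp (Primrec.ite (Primrec.nat_lt.comp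
    (Primrec.list_length.comp Primrec.fst) (Primrec.list_length.comp hv)) ?_ ?_)
  · exact Primrec.sumInl.comp
      (Primrec.list_drop.comp (Primrec.list_length.comp Primrec.fst) hv)
  · refine Primrec.sumInr.comp (Primrec.ite (Primrec.eq.comp hm (Primrec.const (i : ℕ))) ?_ ?_)
    · exact (Primrec.const T₀).pair (Primrec.optionToList.comp
        (Primrec.list_getElem?.comp Primrec.fst (Primrec.list_length.comp hv)))
    · refine (Primrec.option_getD.comp
        (Primrec.list_getElem?.comp (Primrec.const _) hm) (Primrec.const T')).pair ?_
      exact Primrec.ite (Primrec.nat_lt.comp hm (Primrec.const n))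
        ((primrec_pick n).comp hm Primrec.snd) Primrec.snd

theorem primrec_reject [Primcodable S] (i : Fin n) : Primrec₂ (reject i : List S → List S → List S) := by
  classical
  have hv : Primrec fun s : List S × List S => pick n i s.2 :=
    (primrec_pick n).comp (Primrec.const (i : ℕ)) Primrec.snd
  exact Primrec.ite (Primrec.eq.comp
    (Primrec.list_take.comp (Primrec.list_length.comp Primrec.fst) hv)
    (Primrec.list_take.comp (Primrec.list_length.comp hv) Primrec.fst))
    Primrec.snd (Primrec.const [])


theorem reject_of_prefix {i : Fin n} {x L : List S} (h : pick n i L <+: x) :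
    reject i x L = L := by
  rw [reject, if_pos]
  obtain ⟨t, rfl⟩ := h
  simp

/-- The test in `reject` compares only up to the shorter length, so a simulation that has run past
the end of `x` is kept and can halt. -/
theorem reject_of_prefix' {i : Fin n} {x L : List S} (h : x <+: pick n i L) :
    reject i x L = L := by
  rw [reject, if_pos]
  obtain ⟨t, ht⟩ := h
  simp [← ht]

theorem sampleAct_of_prefix {i : Fin n} (T : Fin n → Machine) (T' T₀ : Machine) {x L : List S}
    (h : pick n i L <+: x) :
    sampleAct i T T' T₀ (x, L) = .inr (
      if L.length % (2 * n) = i then (T₀, x[(pick n i L).length]?.toList)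
      else ((List.ofFn T)[L.length % (2 * n)]?.getD T',
        if L.length % (2 * n) < n then pick n (L.length % (2 * n)) L else L)) := by
  rw [sampleAct, if_neg (not_lt.mpr h.length_le)]

end Sampling

/-! ### One round of the simulated game -/

section SampleGame

variable {n : ℕ} {A E : Type*}

theorem length_encJoint_append_mod {H : JointHistory n A E} {L : List (A ⊕ E)}
    (hL : L.length < 2 * n) : (encJoint H ++ L).length % (2 * n) = L.length := by
  rw [List.length_append, length_encJoint, Nat.mul_add_mod, Nat.mod_eq_of_lt hL]

variable [Fintype A]

/-- The probability that the other players than `i` choose their parts of the action vector `b`. -/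
def othersAct (π : Fin n → Policy A E) (i : Fin n) (H : JointHistory n A E) (b : Fin n → A) : ℝ :=
  ∏ j ∈ Finset.univ.erase i, π j (view j H) (b j)

theorem othersAct_nonneg (π : Fin n → Policy A E) (i : Fin n) (H : JointHistory n A E)
    (b : Fin n → A) : 0 ≤ othersAct π i H b :=
  Finset.prod_nonneg fun _ _ => stdSimplex.zero_le _ _

/-- One player's action is sampled. -/
theorem sum_sampleAct_le [Primcodable A] [Primcodable E] {O : Oracle (A ⊕ E)} {i : Fin n}
    {T : Fin n → Machine} {T' T₀ : Machine} {x : List (A ⊕ E)} {W : List (A ⊕ E) → ℝ}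
    (hT₀ : ∀ z : List (A ⊕ E), outProb O T₀ z z = 1)
    (hW : ∀ L T₁ x', sampleAct i T T' T₀ (x, L) = .inr (T₁, x') → ∀ F : Finset (List (A ⊕ E)),
      ∑ z ∈ F, outProb O T₁ x' z * W (reject i x (L ++ z)) ≤ W L)
    {π : Fin n → Policy A E} (hT : ∀ j h a, π j h a = lam O (T j) (encHist h) (.inl a))
    {H : JointHistory n A E} {a : A} (hx : encHist (view i H) ++ [.inl a] <+: x)
    [DecidableEq A] (m : Fin n) (b : Fin m → A)
    (hb : ∀ k : Fin m, (k : ℕ) = i → b k = a) :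
    ∑ α, (if m = i then (if α = a then 1 else 0) else π m (view m H) α) *
        W (encJoint H ++ List.ofFn (fun k => .inl (b k)) ++ [.inl α])
      ≤ W (encJoint H ++ List.ofFn fun k => .inl (b k)) := by
  classical
  have hlen : (encJoint H ++ List.ofFn fun k => (.inl (b k) : A ⊕ E)).length % (2 * n) = m := by
    rw [length_encJoint_append_mod (by simp; omega)]
    simp
  -- Players from `m` on have not yet acted in this round.
  have hpick (j : Fin n) (hj : m ≤ j) :
      pick n j (encJoint H ++ List.ofFn fun k => (.inl (b k) : A ⊕ E)) = encHist (view j H) := by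
    rw [pick_encJoint_append, pick_of_length_le _ (by simp)]
    simp [hj]
  have hpickc (α : A) : (m = i → α = a) → pick n i
      (encJoint H ++ List.ofFn (fun k => (.inl (b k) : A ⊕ E)) ++ [.inl α]) <+: x := by
    intro hα
    refine List.IsPrefix.trans ?_ hx
    rw [List.append_assoc, pick_encJoint_append, pick_of_length_le _ (by simp),
      List.prefix_append_right_inj]
    rcases lt_trichotomy (i : ℕ) m with h | h | h
    · rw [List.getElem?_append_left (by simpa using h)]
      simp [h, hb ⟨i, h⟩ rfl]
    · rw [List.getElem?_append_right (by simp [h])]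
      simp [h, hα (Fin.ext h.symm)]
    · rw [List.getElem?_eq_none (by simp; omega)]
      simp
  have hpre : pick n i (encJoint H ++ List.ofFn fun k => (.inl (b k) : A ⊕ E)) <+: x := by
    refine List.IsPrefix.trans ?_ hx
    rw [pick_encJoint_append, pick_of_length_le _ (by simp), List.prefix_append_right_inj]
    by_cases h : (i : ℕ) < m
    · simp [h, hb ⟨i, h⟩ rfl]
    · simp [h]
  by_cases hm : m = i
  · subst hm
    simp only [if_true, ite_mul, one_mul, zero_mul, Finset.sum_ite_eq', Finset.mem_univ]
    have hget : x[(encHist (view m H)).length]? = some (.inl a) := by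
      obtain ⟨t, rfl⟩ := hx
      simp
    have hact := sampleAct_of_prefix T T' T₀ hpre
    rw [hlen, if_pos rfl, hpick m le_rfl, hget] at hact
    -- Player `i`'s action is an echo of the next input symbol, which is `a`.
    have h := hW _ _ _ hact {[.inl a]}
    rw [Finset.sum_singleton, Option.toList_some, hT₀, one_mul] at h
    rwa [reject_of_prefix (hpickc a fun _ => rfl)] at h
  · have hm' : (m : ℕ) ≠ i := fun h => hm (Fin.ext h)
    simp only [hm, if_false]
    have hact := sampleAct_of_prefix T T' T₀ hpre
    rw [hlen, if_neg hm', if_pos m.2, hpick m le_rfl] at hact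
    have h := hW _ _ _ hact (Finset.univ.image fun α : A => [.inl α])
    rw [Finset.sum_image fun α _ β _ h => by simpa using h] at h
    refine le_trans (Finset.sum_le_sum fun α _ => le_of_eq ?_) h
    have : (List.ofFn T)[(m : ℕ)]?.getD T' = T m := by simp
    rw [hT, lam, this, reject_of_prefix (hpickc α fun h => absurd h hm)]

theorem sum_fin_succ_fun {X M : Type*} [Fintype X] [AddCommMonoid M] {m : ℕ}
    (f : (Fin (m + 1) → X) → M) :
    ∑ w, f w = ∑ w : Fin m → X, ∑ z, f (Fin.snoc w z) := by
  rw [← (Fin.snocEquiv fun _ => X).sum_comp, Fintype.sum_prod_type, Finset.sum_comm]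
  rfl

theorem ofFn_snoc {X Y : Type*} {m : ℕ} (g : X → Y) (w : Fin m → X) (z : X) :
    (List.ofFn fun k => g ((Fin.snoc w z : Fin (m + 1) → X) k)) =
      List.ofFn (fun k => g (w k)) ++ [g z] := by
  rw [List.ofFn_succ']
  simp

/-- All players' actions are sampled. -/
theorem sum_sampleActs_le [Primcodable A] [Primcodable E] {O : Oracle (A ⊕ E)} {i : Fin n}
    {T : Fin n → Machine} {T' T₀ : Machine} {x : List (A ⊕ E)} {W : List (A ⊕ E) → ℝ}
    (hT₀ : ∀ z : List (A ⊕ E), outProb O T₀ z z = 1)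
    (hW : ∀ L T₁ x', sampleAct i T T' T₀ (x, L) = .inr (T₁, x') → ∀ F : Finset (List (A ⊕ E)),
      ∑ z ∈ F, outProb O T₁ x' z * W (reject i x (L ++ z)) ≤ W L)
    {π : Fin n → Policy A E} (hT : ∀ j h a, π j h a = lam O (T j) (encHist h) (.inl a))
    {H : JointHistory n A E} {a : A} (hx : encHist (view i H) ++ [.inl a] <+: x)
    [DecidableEq A] :
    ∑ b : Fin n → A, (if b i = a then othersAct π i H b * W (encGameInput H b) else 0)
      ≤ W (encJoint H) := by
  -- Player `i`'s policy is replaced by the point mass at `a`, which makes the weight a product over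
  -- all players.
  set q : Fin n → A → ℝ := fun m α =>
    if m = i then (if α = a then 1 else 0) else π m (view m H) α with hq
  have hq0 (m α) : 0 ≤ q m α := by
    simp only [hq]
    split_ifs <;> simp
  have key (m : ℕ) (hm : m ≤ n) : ∑ b : Fin m → A, (∏ k, q (k.castLE hm) (b k)) *
      W (encJoint H ++ List.ofFn fun k => .inl (b k)) ≤ W (encJoint H) := by
    induction m with
    | zero => simp
    | succ m ih =>
      refine le_trans ?_ (ih (Nat.le_of_succ_le hm))
      rw [sum_fin_succ_fun]
      refine Finset.sum_le_sum fun b _ => ?_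
      simp only [Fin.prod_univ_castSucc, Fin.snoc_castSucc, Fin.snoc_last, ofFn_snoc, mul_assoc,
        ← Finset.mul_sum, ← List.append_assoc]
      change (∏ k, q (k.castLE (Nat.le_of_succ_le hm)) (b k)) * _ ≤ _
      -- A partial action vector in which player `i` deviates from `a` has weight 0, so nothing has
      -- to be known about `W` there.
      by_cases hb : ∀ k : Fin m, (k : ℕ) = i → b k = a
      · exact mul_le_mul_of_nonneg_left (sum_sampleAct_le hT₀ hW hT hx ⟨m, hm⟩ b hb)
          (Finset.prod_nonneg fun _ _ => hq0 _ _)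
      · push Not at hb
        obtain ⟨k, hk, hka⟩ := hb
        have : q (k.castLE (Nat.le_of_succ_le hm)) (b k) = 0 := by
          simp only [hq]
          rw [if_pos (Fin.ext hk), if_neg hka]
        rw [Finset.prod_eq_zero (Finset.mem_univ k) this]
        simp
  refine le_trans (Finset.sum_le_sum fun b _ => le_of_eq ?_) (key n le_rfl)
  change _ = (∏ k, q k (b k)) * W (encGameInput H b)
  rw [← Finset.mul_prod_erase _ _ (Finset.mem_univ i)]
  have : ∏ k ∈ Finset.univ.erase i, q k (b k) = othersAct π i H b :=
    Finset.prod_congr rfl fun k hk => by simp only [hq]; rw [if_neg (Finset.ne_of_mem_erase hk)]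
  rw [this]
  by_cases h : b i = a <;> simp [hq, h]

/-- All players' actions and the percept vector are sampled. -/
theorem sum_sampleRound_le [Fintype E] [Primcodable A] [Primcodable E] {O : Oracle (A ⊕ E)} {i : Fin n}
    {T : Fin n → Machine} {T' T₀ : Machine} {x : List (A ⊕ E)} {W : List (A ⊕ E) → ℝ}
    (hT₀ : ∀ z : List (A ⊕ E), outProb O T₀ z z = 1)
    (hW : ∀ L T₁ x', sampleAct i T T' T₀ (x, L) = .inr (T₁, x') → ∀ F : Finset (List (A ⊕ E)),
      ∑ z ∈ F, outProb O T₁ x' z * W (reject i x (L ++ z)) ≤ W L)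
    {π : Fin n → Policy A E} (hT : ∀ j h a, π j h a = lam O (T j) (encHist h) (.inl a))
    {σ : Game n A E}
    (hT' : ∀ H b e, σ H b e = outProb O T' (encGameInput H b) (List.ofFn fun j => .inr (e j)))
    {H : JointHistory n A E} {a : A} (hx : encHist (view i H) ++ [.inl a] <+: x)
    [DecidableEq A] :
    ∑ z : (Fin n → A) × (Fin n → E), (if z.1 i = a then
        othersAct π i H z.1 * σ H z.1 z.2 * W (reject i x (encJoint (H ++ [z]))) else 0)
      ≤ W (encJoint H) := by
  classical
  refine le_trans ?_ (sum_sampleActs_le hT₀ hW hT hx)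
  rw [Fintype.sum_prod_type]
  refine Finset.sum_le_sum fun b _ => ?_
  by_cases hb : b i = a
  · simp only [hb, if_true, mul_assoc, ← Finset.mul_sum]
    refine mul_le_mul_of_nonneg_left ?_ (othersAct_nonneg _ _ _ _)
    have hn : 0 < n := i.pos
    have hlen : (encGameInput (E := E) H b).length % (2 * n) = n := by
      rw [encGameInput_eq, length_encJoint_append_mod (by simp; omega)]
      simp
    have hpre : pick n i (encGameInput (E := E) H b) <+: x := by
      rw [encGameInput_eq, pick_encJoint_append, pick_ofFn, hb]
      exact hx
    have hact := sampleAct_of_prefix T T' T₀ hpre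
    rw [hlen, if_neg i.2.ne', if_neg (lt_irrefl n), List.getElem?_eq_none (by simp)] at hact
    have h := hW _ _ _ hact (Finset.univ.image
      fun e : Fin n → E => List.ofFn fun j => (.inr (e j) : A ⊕ E))
    rw [Finset.sum_image fun e _ f _ h =>
      funext fun j => Sum.inr_injective (congrFun (List.ofFn_injective h) j)] at h
    refine le_trans (Finset.sum_le_sum fun e _ => le_of_eq ?_) h
    rw [hT', encJoint_concat]
    rfl
  · simp [hb]

end SampleGame

/-! ## Sums over histories -/

section Sums

theorem prod_take_concat {X M : Type*} [CommMonoid M] (f : List X → X → M) (L : List X) (z : X) :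
    ∏ s : Fin (L ++ [z]).length, f ((L ++ [z]).take s) ((L ++ [z]).get s) =
      (∏ s : Fin L.length, f (L.take s) (L.get s)) * f L z := by
  have h : (L ++ [z]).length = L.length + 1 := by simp
  rw [← (finCongr h.symm).prod_comp, Fin.prod_univ_castSucc]
  congr 1
  · refine Finset.prod_congr rfl fun s _ => ?_
    simp [List.take_append_of_le_length s.2.le, List.getElem_append_left s.2]
  · simp

theorem sum_ofFn_succ {X M : Type*} [Fintype X] [AddCommMonoid M] (F : List X → M) (t : ℕ) :
    ∑ w : Fin (t + 1) → X, F (List.ofFn w) =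
      ∑ w : Fin t → X, ∑ z, F (List.ofFn w ++ [z]) := by
  rw [sum_fin_succ_fun]
  exact Finset.sum_congr rfl fun w _ => Finset.sum_congr rfl fun z _ =>
    congrArg F (ofFn_snoc id w z)

variable {n : ℕ} {A E : Type*} [Fintype A]

theorem contProb_nil (ν : Environment A E) (π : Policy A E) (h : List (A × E)) :
    contProb ν π h [] = 1 := by
  simp [contProb]

theorem contProb_concat (ν : Environment A E) (π : Policy A E) (h w : List (A × E)) (z : A × E) :
    contProb ν π h (w ++ [z]) =
      contProb ν π h w * (π (h ++ w) z.1 * ν (h ++ w) z.1 z.2) :=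
  prod_take_concat (fun L (z : A × E) => π (h ++ L) z.1 * ν (h ++ L) z.1 z.2) w z

/-- The part of player `i` in the probability of their own history `h`. -/
def policyProb (ρ : Policy A E) (h : List (A × E)) : ℝ :=
  ∏ s : Fin h.length, ρ (h.take s) (h.get s).1

theorem policyProb_nil (ρ : Policy A E) : policyProb ρ [] = 1 := by
  simp [policyProb]

theorem policyProb_concat (ρ : Policy A E) (h : List (A × E)) (z : A × E) :
    policyProb ρ (h ++ [z]) = policyProb ρ h * ρ h z.1 :=
  prod_take_concat (fun h z => ρ h z.1) h z

open Classical in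
/-- Given player `i`'s action, the other actions and the percepts have total probability 1. -/
theorem sum_othersAct (π : Fin n → Policy A E) (i : Fin n) (H : JointHistory n A E) (a : A) :
    ∑ b : Fin n → A, (if b i = a then othersAct π i H b else 0) = 1 := by
  have h (b : Fin n → A) : (if b i = a then othersAct π i H b else 0) =
      ∏ j, if j = i then (if b j = a then 1 else 0) else π j (view j H) (b j) := by
    rw [← Finset.mul_prod_erase _ _ (Finset.mem_univ i), if_pos rfl, ite_mul, one_mul, zero_mul]
    congr 1
    exact Finset.prod_congr rfl fun j hj => (if_neg (Finset.ne_of_mem_erase hj)).symm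
  simp only [h]
  rw [← Fintype.prod_sum fun j α =>
    if j = i then (if α = a then 1 else 0) else π j (view j H) α]
  refine Finset.prod_eq_one fun j _ => ?_
  split_ifs with hj
  · simp
  · exact stdSimplex.sum_eq_one _

variable [Fintype E] (σ : Game n A E) (π : Fin n → Policy A E) (i : Fin n)

theorem othersProb_nil : othersProb σ π i [] = 1 := by
  simp [othersProb]

theorem othersProb_concat (H : JointHistory n A E) (z : (Fin n → A) × (Fin n → E)) :
    othersProb σ π i (H ++ [z]) =
      othersProb σ π i H * (othersAct π i H z.1 * σ H z.1 z.2) :=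
  prod_take_concat (fun H z => othersAct π i H z.1 * σ H z.1 z.2) H z

theorem othersProb_nonneg (H : JointHistory n A E) : 0 ≤ othersProb σ π i H :=
  Finset.prod_nonneg fun _ _ => mul_nonneg (othersAct_nonneg _ _ _ _) (stdSimplex.zero_le _ _)

/-- Player `i`'s own factors depend on the joint history only through `view i H`; therefore they
come out of every marginal at a fixed own history. -/
theorem gameProb_eq (H : JointHistory n A E) :
    gameProb σ π H = policyProb (π i) (view i H) * othersProb σ π i H := by
  induction H using List.reverseRecOn with
  | nil => simp [gameProb, view, policyProb_nil, othersProb_nil]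
  | append_singleton H z ih =>
    have h : gameProb σ π (H ++ [z]) =
        gameProb σ π H * ((∏ j, π j (view j H) (z.1 j)) * σ H z.1 z.2) :=
      prod_take_concat (fun H z => (∏ j, π j (view j H) (z.1 j)) * σ H z.1 z.2) H z
    rw [h, ih, view_concat, policyProb_concat, othersProb_concat,
      ← Finset.mul_prod_erase _ _ (Finset.mem_univ i), othersAct]
    ring

open Classical in
/-- The sum of `F` over the joint histories with player `i`'s history `h`. -/
def marginal (F : JointHistory n A E → ℝ) (h : List (A × E)) : ℝ :=
  ∑ w : Fin h.length → (Fin n → A) × (Fin n → E),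
    if view i (List.ofFn w) = h then F (List.ofFn w) else 0

theorem marginal_nil (F : JointHistory n A E → ℝ) : marginal i F [] = F [] := by
  simp [marginal, view]

open Classical in
theorem marginal_concat (F : JointHistory n A E → ℝ) (h : List (A × E)) (z : A × E) :
    marginal i F (h ++ [z]) = marginal i
      (fun H => ∑ y : (Fin n → A) × (Fin n → E),
        if y.1 i = z.1 ∧ y.2 i = z.2 then F (H ++ [y]) else 0) h := by
  have hlen : (h ++ [z]).length = h.length + 1 := by simp
  have : marginal i F (h ++ [z]) =
      ∑ w : Fin (h.length + 1) → (Fin n → A) × (Fin n → E),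
        if view i (List.ofFn w) = h ++ [z] then F (List.ofFn w) else 0 := by
    rw [marginal]
    -- The length occurs in the index type `Fin`, so it has to be replaced by a variable before it
    -- can be rewritten.
    generalize hm : (h ++ [z]).length = m
    rw [hlen] at hm
    subst hm
    rfl
  rw [this, sum_ofFn_succ fun H => if view i H = h ++ [z] then F H else 0]
  refine Finset.sum_congr rfl fun w _ => ?_
  by_cases hw : view i (List.ofFn w) = h
  · simp [view_concat, hw, Prod.ext_iff]
  · simp [view_concat, hw]

theorem marginal_mono {F G : JointHistory n A E → ℝ} {h : List (A × E)}
    (hFG : ∀ H, view i H = h → F H ≤ G H) : marginal i F h ≤ marginal i G h := by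
  refine Finset.sum_le_sum fun w _ => ?_
  split_ifs with hw
  · exact hFG _ hw
  · rfl

theorem marginal_congr {F G : JointHistory n A E → ℝ} {h : List (A × E)}
    (hFG : ∀ H, view i H = h → F H = G H) : marginal i F h = marginal i G h :=
  (marginal_mono i fun H hH => (hFG H hH).le).antisymm
    (marginal_mono i fun H hH => (hFG H hH).ge)

theorem marginal_const_mul (c : ℝ) (F : JointHistory n A E → ℝ) (h : List (A × E)) :
    marginal i (fun H => c * F H) h = c * marginal i F h := by
  classical
  rw [marginal, marginal, Finset.mul_sum]
  exact Finset.sum_congr rfl fun w _ => (mul_ite_zero _ _ _).symm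

theorem marginal_sub (F G : JointHistory n A E → ℝ) (h : List (A × E)) :
    marginal i (fun H => F H - G H) h = marginal i F h - marginal i G h := by
  rw [marginal, marginal, marginal, ← Finset.sum_sub_distrib]
  refine Finset.sum_congr rfl fun w _ => ?_
  split_ifs <;> simp

theorem marginal_nonneg {F : JointHistory n A E → ℝ} (hF : ∀ H, 0 ≤ F H) (h : List (A × E)) :
    0 ≤ marginal i F h :=
  Finset.sum_nonneg fun w _ => by split_ifs <;> simp [hF]

/-- The marginals of `F` sum to the sum of `F`. -/
theorem sum_marginal (F : JointHistory n A E → ℝ) (t : ℕ) :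
    ∑ w : Fin t → A × E, marginal i F (List.ofFn w) =
      ∑ w : Fin t → (Fin n → A) × (Fin n → E), F (List.ofFn w) := by
  classical
  have h (w : Fin t → A × E) : marginal i F (List.ofFn w) =
      ∑ v : Fin t → (Fin n → A) × (Fin n → E),
        if (fun k => ((v k).1 i, (v k).2 i)) = w then F (List.ofFn v) else 0 := by
    rw [marginal]
    have hl : (List.ofFn w).length = t := by simp
    trans ∑ v : Fin t → (Fin n → A) × (Fin n → E),
        if view i (List.ofFn v) = List.ofFn w then F (List.ofFn v) else 0
    · generalize List.ofFn w = l at hl ⊢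
      subst hl
      rfl
    · refine Finset.sum_congr rfl fun v _ => ?_
      have : view i (List.ofFn v) = List.ofFn fun k => ((v k).1 i, (v k).2 i) := by
        simp [view, List.map_ofFn, Function.comp_def]
      simp only [this, List.ofFn_inj]
  simp only [h]
  rw [Finset.sum_comm]
  simp

open Classical in
theorem sum_othersAct_mul (H : JointHistory n A E) (a : A) :
    ∑ z : (Fin n → A) × (Fin n → E),
      (if z.1 i = a then othersAct π i H z.1 * σ H z.1 z.2 else 0) = 1 := by
  rw [Fintype.sum_prod_type, ← sum_othersAct π i H a]
  refine Finset.sum_congr rfl fun b _ => ?_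
  split_ifs
  · simp only [← Finset.mul_sum, stdSimplex.sum_eq_one, mul_one]
  · simp

/-- In the denominator, the other players' action probabilities sum to 1 once player `i`'s action is
fixed, so the dependence on `a` disappears. -/
theorem subjectiveEnv_eq (h : List (A × E)) (a : A) (e : E) :
    subjectiveEnv σ π i h a e =
      marginal i (othersProb σ π i) (h ++ [(a, e)]) / marginal i (othersProb σ π i) h := by
  classical
  rw [subjectiveEnv]
  congr 1
  · rw [marginal]
    have hlen : (h ++ [(a, e)]).length = h.length + 1 := by simp
    generalize hm : (h ++ [(a, e)]).length = m
    rw [hlen] at hm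
    subst hm
    refine Finset.sum_congr rfl fun w _ => ?_
    congr
  · refine Finset.sum_congr rfl fun w _ => ?_
    by_cases hw : view i (List.ofFn w) = h
    · simp only [hw, true_and, if_true]
      refine Eq.trans ?_ (mul_one _)
      rw [← sum_othersAct π i (List.ofFn w) a, Finset.mul_sum]
      refine Finset.sum_congr rfl fun b _ => ?_
      by_cases hb : b i = a
      · simp only [hb, if_true]
        rfl
      · simp [hb]
    · simp [hw]

theorem sum_marginal_concat (h : List (A × E)) (a : A) :
    ∑ e, marginal i (othersProb σ π i) (h ++ [(a, e)]) = marginal i (othersProb σ π i) h := by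
  classical
  simp only [marginal_concat]
  simp only [marginal]
  rw [Finset.sum_comm]
  refine Finset.sum_congr rfl fun w _ => ?_
  split_ifs with hw
  · rw [Finset.sum_comm]
    simp only [othersProb_concat]
    refine Eq.trans ?_ (mul_one _)
    rw [← sum_othersAct_mul σ π i (List.ofFn w) a, Finset.mul_sum]
    refine Finset.sum_congr rfl fun z _ => ?_
    by_cases hz : z.1 i = a <;> simp [hz]
  · simp

end Sums

/-! ## The machine that samples from a subjective environment -/

section Subjective

variable {n : ℕ} {A E : Type*} [Fintype A] [Fintype E] [Primcodable A] [Primcodable E]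

/-- Correctness of rejection sampling, as a lower bound. The denominator of $\sigma_i(e\mid ha)$ is
multiplied out, so impossible histories need no separate treatment. -/
theorem exists_subjectiveMachine {O : Oracle (A ⊕ E)} {σ : Game n A E} (hσ : IsROCGame O σ)
    {π : Fin n → Policy A E} (hπ : ∀ i, IsROCPolicy O (π i)) (i : Fin n) :
    ∃ T : Machine, ∀ h a e, marginal i (othersProb σ π i) (h ++ [(a, e)]) ≤
      lam O T (encHist h ++ [.inl a]) (.inr e) * marginal i (othersProb σ π i) h := by
  classical
  obtain ⟨T', hT'⟩ := hσ
  choose T hT using hπ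
  obtain ⟨T₀, hT₀⟩ := exists_echoMachine O
  obtain ⟨M, W, hW0, hWM, hWhalt, hWcall⟩ := exists_callingMachine O
    (init := fun x : List (A ⊕ E) => (x, ([] : List (A ⊕ E))))
    (act := sampleAct i T T' T₀) (ret := fun s z => (s.1, reject i s.1 (s.2 ++ z)))
    (Computable.id.pair (Computable.const [])) (computable_sampleAct i T T' T₀)
    (((Primrec.fst.comp Primrec.fst).pair ((primrec_reject i).comp (Primrec.fst.comp Primrec.fst)
      (Primrec.list_append.comp (Primrec.snd.comp Primrec.fst) Primrec.snd))).to_comp).to₂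
  refine ⟨M, fun h a e => ?_⟩
  set x : List (A ⊕ E) := encHist h ++ [.inl a] with hx
  set G : List (A ⊕ E) → ℝ := fun L => W [.inr e] (x, L) with hG
  have hround {H : JointHistory n A E} {a : A} (hx : encHist (view i H) ++ [.inl a] <+: x) :
      ∑ z : (Fin n → A) × (Fin n → E), (if z.1 i = a then
        othersAct π i H z.1 * σ H z.1 z.2 * G (reject i x (encJoint (H ++ [z]))) else 0)
      ≤ G (encJoint H) :=
    sum_sampleRound_le hT₀ (fun L T₁ x' h => hWcall [.inr e] (x, L) T₁ x' h) hT hT' hx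
  -- Subtracting `G []` makes restarts contribute 0. The marginal vanishes at the empty prefix and
  -- does not increase when the prefix of `h` is extended by one interaction.
  have key (h₁ h₂ : List (A × E)) (hh : h₁ ++ h₂ = h) :
      marginal i (fun H => othersProb σ π i H * (G (encJoint H) - G [])) h₁ ≤ 0 := by
    induction h₁ using List.reverseRecOn generalizing h₂ with
    | nil => simp [marginal_nil, encJoint]
    | append_singleton l z ih =>
      refine le_trans ?_ (ih ([z] ++ h₂) (by simpa using hh))
      rw [marginal_concat]
      refine marginal_mono i fun H hH => ?_
      simp only [othersProb_concat]
      have hxz : x = encHist l ++ [.inl z.1] ++ (.inr z.2 :: (encHist h₂ ++ [.inl a])) := by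
        rw [hx, ← hh, encHist_append, encHist_concat]
        simp
      have hr := hround (H := H) (a := z.1) (by rw [hH, hxz]; exact List.prefix_append _ _)
      have hrej (y : (Fin n → A) × (Fin n → E)) (hy : y.1 i = z.1) :
          reject i x (encJoint (H ++ [y])) =
            if y.2 i = z.2 then encJoint (H ++ [y]) else [] := by
        have : pick n i (encJoint (H ++ [y])) = encHist l ++ [.inl z.1] ++ [.inr (y.2 i)] := by
          rw [pick_encJoint, view_concat, encHist_concat, hH, hy]
          simp
        split_ifs with h2
        · refine reject_of_prefix ?_
          rw [this, hxz, h2, List.prefix_append_right_inj]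
          simp
        · rw [reject, if_neg]
          rw [this, hxz]
          simp [List.take_append, List.take_of_length_le]
          exact h2
      have hsum : ∑ y : (Fin n → A) × (Fin n → E), (if y.1 i = z.1 then
          othersAct π i H y.1 * σ H y.1 y.2 * (G (reject i x (encJoint (H ++ [y]))) - G [])
            else 0) ≤ G (encJoint H) - G [] := by
        calc _ = ∑ y : (Fin n → A) × (Fin n → E), (if y.1 i = z.1 then
              othersAct π i H y.1 * σ H y.1 y.2 * G (reject i x (encJoint (H ++ [y]))) else 0) -
              (∑ y : (Fin n → A) × (Fin n → E), (if y.1 i = z.1 then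
                othersAct π i H y.1 * σ H y.1 y.2 else 0)) * G [] := by
              rw [Finset.sum_mul, ← Finset.sum_sub_distrib]
              refine Finset.sum_congr rfl fun y _ => ?_
              split_ifs <;> ring
          _ ≤ _ := by
              -- The weights of a round sum to 1, so exactly one `G []` is subtracted.
              rw [sum_othersAct_mul, one_mul]
              exact sub_le_sub_right hr _
      refine le_trans (le_of_eq ?_)
        (mul_le_mul_of_nonneg_left hsum (othersProb_nonneg σ π i H))
      rw [Finset.mul_sum]
      refine Finset.sum_congr rfl fun y _ => ?_
      by_cases hy : y.1 i = z.1
      · by_cases hy' : y.2 i = z.2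
        · simp [hy, hy', hrej, mul_assoc]
        · simp [hy, hy', hrej]
      · simp [hy]
  have hle : G [] ≤ lam O M x (.inr e) := hWM _ _
  calc marginal i (othersProb σ π i) (h ++ [(a, e)])
      ≤ marginal i (fun H => othersProb σ π i H * G (encJoint H)) h := by
        rw [marginal_concat]
        refine marginal_mono i fun H hH => ?_
        have hr := hround (H := H) (a := a) (by rw [hH])
        refine le_trans ?_ (mul_le_mul_of_nonneg_left hr (othersProb_nonneg σ π i H))
        rw [Finset.mul_sum]
        refine Finset.sum_le_sum fun y _ => ?_
        have h0 : 0 ≤ othersAct π i H y.1 * σ H y.1 y.2 :=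
          mul_nonneg (othersAct_nonneg _ _ _ _) (stdSimplex.zero_le _ _)
        by_cases hy : y.1 i = a
        · by_cases hy' : y.2 i = e
          · have hpick : pick n i (encJoint (H ++ [y])) = x ++ [.inr e] := by
              rw [pick_encJoint, view_concat, encHist_concat, hH, hy, hy']
              simp [hx]
            -- Player `i`'s part is now one symbol longer than `x`; the machine halts and outputs
            -- that symbol, `e`. Rounds with another percept are dropped below, since `W` is
            -- nonnegative.
            have h1 : 1 ≤ G (encJoint (H ++ [y])) := by
              refine hWhalt _ _ ?_
              simp [sampleAct, hpick]
            rw [reject_of_prefix' (by rw [hpick]; exact List.prefix_append _ _)]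
            simp only [hy, hy', and_self, if_true, othersProb_concat]
            exact mul_le_mul_of_nonneg_left (le_mul_of_one_le_right h0 h1)
              (othersProb_nonneg σ π i H)
          · simp only [hy, hy', and_false, if_false, if_true]
            exact mul_nonneg (othersProb_nonneg σ π i H) (mul_nonneg h0 (hW0 _ _))
        · simp [hy]
    _ ≤ G [] * marginal i (othersProb σ π i) h := by
        have := key h [] (by simp)
        simp only [mul_sub, marginal_sub] at this
        rw [← marginal_const_mul]
        simp only [mul_comm (G [])]
        linarith
    _ ≤ _ := mul_le_mul_of_nonneg_right hle (marginal_nonneg i (othersProb_nonneg σ π i) h)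

end Subjective

/-! ## Values -/

section Values

variable {A E : Type*} [Fintype A] {ν : Environment A E}

theorem contProb_nonneg (hν : ∀ h a e, 0 ≤ ν h a e) (π : Policy A E) (h w : List (A × E)) :
    0 ≤ contProb ν π h w :=
  Finset.prod_nonneg fun _ _ => mul_nonneg (stdSimplex.zero_le _ _) (hν _ _ _)

variable [Fintype E]

theorem sum_policy_mul (hν' : ∀ h a, ∑ e, ν h a e = 1) (π : Policy A E) (h : List (A × E)) :
    ∑ z : A × E, π h z.1 * ν h z.1 z.2 = 1 := by
  rw [Fintype.sum_prod_type]
  simp only [← Finset.mul_sum, hν', mul_one, stdSimplex.sum_eq_one]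

theorem sum_contProb (hν' : ∀ h a, ∑ e, ν h a e = 1) (π : Policy A E) (h : List (A × E)) (m : ℕ) :
    ∑ w : Fin m → A × E, contProb ν π h (List.ofFn w) = 1 := by
  induction m with
  | zero => simp [contProb_nil]
  | succ m ih =>
    rw [sum_ofFn_succ]
    simp only [contProb_concat, ← Finset.mul_sum, sum_policy_mul hν', mul_one, ih]

variable {r : E → ℝ} {γ : ℕ → ℝ}

/-- Monotonicity, together with the bound `rewardSum_le`, ensures that `limUnder` in the value is a
genuine limit. -/
theorem rewardSum_le_succ (hν : ∀ h a e, 0 ≤ ν h a e) (hν' : ∀ h a, ∑ e, ν h a e = 1)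
    (hr : ∀ e, 0 ≤ r e) (hγ : ∀ t, 0 ≤ γ t) (π : Policy A E) (h : List (A × E)) (m : ℕ) :
    rewardSum r γ ν π h m ≤ rewardSum r γ ν π h (m + 1) := by
  rw [rewardSum, rewardSum, sum_fin_succ_fun]
  refine Finset.sum_le_sum fun w _ => ?_
  have hc (z : A × E) : contProb ν π h (List.ofFn (Fin.snoc w z : Fin (m + 1) → A × E)) =
      contProb ν π h (List.ofFn w) *
        (π (h ++ List.ofFn w) z.1 * ν (h ++ List.ofFn w) z.1 z.2) := by
    rw [← contProb_concat]
    exact congrArg _ (ofFn_snoc id w z)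
  rw [← mul_one (contProb ν π h (List.ofFn w)), ← sum_policy_mul hν' π (h ++ List.ofFn w),
    Finset.mul_sum, Finset.mul_sum]
  refine Finset.sum_le_sum fun z _ => ?_
  rw [hc]
  refine mul_le_mul_of_nonneg_right ?_ (mul_nonneg (contProb_nonneg hν _ _ _)
    (mul_nonneg (stdSimplex.zero_le _ _) (hν _ _ _)))
  simp only [Fin.sum_univ_castSucc, Fin.snoc_castSucc, Fin.snoc_last, Fin.val_castSucc]
  exact le_add_of_nonneg_right (mul_nonneg (hγ _) (hr _))

theorem rewardSum_le (hν : ∀ h a e, 0 ≤ ν h a e) (hν' : ∀ h a, ∑ e, ν h a e = 1)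
    (hr : ∀ e, r e ≤ 1) (hγ : ∀ t, 0 ≤ γ t) (hγ' : Summable γ) (π : Policy A E)
    (h : List (A × E)) (m : ℕ) :
    rewardSum r γ ν π h m ≤ discountNorm γ (h.length + 1) := by
  have hs : Summable fun k => γ (h.length + 1 + k) :=
    hγ'.comp_injective (add_right_injective (h.length + 1))
  calc rewardSum r γ ν π h m
      ≤ ∑ w : Fin m → A × E, discountNorm γ (h.length + 1) * contProb ν π h (List.ofFn w) := by
        refine Finset.sum_le_sum fun w _ =>
          mul_le_mul_of_nonneg_right ?_ (contProb_nonneg hν _ _ _)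
        calc ∑ j : Fin m, γ (h.length + 1 + j) * r (w j).2
            ≤ ∑ j : Fin m, γ (h.length + 1 + j) :=
              Finset.sum_le_sum fun j _ => mul_le_of_le_one_right (hγ _) (hr _)
          _ = ∑ j ∈ Finset.range m, γ (h.length + 1 + j) :=
              Fin.sum_univ_eq_sum_range (fun j => γ (h.length + 1 + j)) m
          _ ≤ _ := hs.sum_le_tsum _ fun _ _ => hγ _
    _ = _ := by rw [← Finset.mul_sum, sum_contProb hν', mul_one]

theorem value_le_one (hν : ∀ h a e, 0 ≤ ν h a e) (hν' : ∀ h a, ∑ e, ν h a e = 1)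
    (hr : ∀ e, 0 ≤ r e ∧ r e ≤ 1) (hγ : ∀ t, 0 ≤ γ t) (hγ' : Summable γ) (π : Policy A E)
    (h : List (A × E)) : value r γ ν π h ≤ 1 := by
  have hbdd := rewardSum_le hν hν' (fun e => (hr e).2) hγ hγ' π h
  have hlim := tendsto_atTop_ciSup
    (monotone_nat_of_le_succ (rewardSum_le_succ hν hν' (fun e => (hr e).1) hγ π h))
    ⟨_, Set.forall_mem_range.mpr hbdd⟩
  rw [value, hlim.limUnder_eq, one_div_mul_eq_div]
  -- This includes a vanishing discount sum, where division by zero gives the value 0.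
  exact div_le_one_of_le₀ (ciSup_le hbdd) (tsum_nonneg fun _ => hγ _)

theorem value_le_optValue (hν : ∀ h a e, 0 ≤ ν h a e) (hν' : ∀ h a, ∑ e, ν h a e = 1)
    (hr : ∀ e, 0 ≤ r e ∧ r e ≤ 1) (hγ : ∀ t, 0 ≤ γ t) (hγ' : Summable γ) (π : Policy A E)
    (h : List (A × E)) : value r γ ν π h ≤ optValue r γ ν h :=
  le_ciSup (f := fun π => value r γ ν π h)
    ⟨1, Set.forall_mem_range.mpr fun π => value_le_one hν hν' hr hγ hγ' π h⟩ π

/-- Values see an environment only through continuation probabilities, so environments may differ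
where these vanish. -/
theorem value_congr {μ : Environment A E} {π : Policy A E} {h : List (A × E)}
    (hμ : ∀ w, contProb ν π h w = contProb μ π h w) : value r γ ν π h = value r γ μ π h := by
  have : rewardSum r γ ν π h = rewardSum r γ μ π h :=
    funext fun m => by simp only [rewardSum, hμ]
  rw [value, value, this]

theorem optValue_congr {μ : Environment A E} {h : List (A × E)}
    (hμ : ∀ π w, contProb ν π h w = contProb μ π h w) : optValue r γ ν h = optValue r γ μ h :=
  iSup_congr fun π => value_congr (hμ π)

end Values

/-! ## Subjective environments -/

section Equilibrium

variable {n : ℕ} {A E : Type*} [Fintype A] [Fintype E] (σ : Game n A E) (π : Fin n → Policy A E)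
  (i : Fin n)

/-- The conditional probabilities are quotients of successive marginals, and their product
telescopes. -/
theorem contProb_subjectiveEnv (h : List (A × E)) :
    contProb (subjectiveEnv σ π i) (π i) [] h = marginal i (gameProb σ π) h := by
  have hg : marginal i (gameProb σ π) h =
      policyProb (π i) h * marginal i (othersProb σ π i) h := by
    rw [← marginal_const_mul]
    exact marginal_congr i fun H hH => by rw [gameProb_eq σ π i, hH]
  rw [hg]
  clear hg
  induction h using List.reverseRecOn with
  | nil => rw [contProb_nil, policyProb_nil, marginal_nil, othersProb_nil, one_mul]
  | append_singleton h z ih =>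
    rw [contProb_concat, ih, policyProb_concat, List.nil_append, subjectiveEnv_eq]
    -- If the denominator vanishes, so does the marginal of every extension, and both sides are 0.
    by_cases h0 : marginal i (othersProb σ π i) h = 0
    · have := (Finset.sum_eq_zero_iff_of_nonneg fun e _ => marginal_nonneg i
        (othersProb_nonneg σ π i) _).mp ((sum_marginal_concat σ π i h z.1).trans h0) z.2
        (Finset.mem_univ _)
      rw [h0, this]
      simp
    · field_simp

/-- An environment that agrees with the subjective environment on the histories that can occur. -/
theorem contProb_congr_of_agree {μ : Environment A E}
    (hμ : ∀ h, marginal i (othersProb σ π i) h ≠ 0 → ∀ a e, subjectiveEnv σ π i h a e = μ h a e)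
    {h : List (A × E)} (hh : marginal i (othersProb σ π i) h ≠ 0) (ρ : Policy A E)
    (w : List (A × E)) :
    contProb (subjectiveEnv σ π i) ρ h w = contProb μ ρ h w ∧
      (contProb μ ρ h w ≠ 0 → marginal i (othersProb σ π i) (h ++ w) ≠ 0) := by
  induction w using List.reverseRecOn with
  | nil => simp [contProb_nil, hh]
  | append_singleton w z ih =>
    rw [contProb_concat, contProb_concat, ih.1]
    by_cases hw : contProb μ ρ h w = 0
    · simp [hw]
    · have hhw := ih.2 hw
      rw [hμ _ hhw]
      -- If the extension were impossible, the subjective probability of its last percept would be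
      -- 0, and by agreement so would that of `μ`.
      refine ⟨rfl, fun h0 h1 => h0 ?_⟩
      rw [← hμ _ hhw, subjectiveEnv_eq, List.append_assoc, h1]
      simp

variable [Primcodable A] [Primcodable E]

/-- Up to histories that cannot occur, subjective environments are in the reflective class. -/
theorem exists_reflEnvironment_agree {O : Oracle (A ⊕ E)} (hO : IsReflective O)
    (hσ : IsROCGame O σ) (hπ : ∀ i, IsROCPolicy O (π i)) :
    ∃ μ ∈ reflEnvironments hO, (∀ h a e, 0 ≤ μ h a e) ∧ (∀ h a, ∑ e, μ h a e = 1) ∧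
      ∀ h, marginal i (othersProb σ π i) h ≠ 0 → ∀ a e, subjectiveEnv σ π i h a e = μ h a e := by
  obtain ⟨T, hT⟩ := exists_subjectiveMachine hσ hπ i
  have hq (x) : IsCompletion O T x (completion hO T x) := (hO T x).choose_spec
  refine ⟨fun h a e => completion hO T (encHist h ++ [.inl a]) (.inr e), ⟨T, fun _ _ _ => rfl⟩,
    fun h a e => (outProb_nonneg O _ _).trans ((hq _).lower _), fun h a => (hq _).sum_inr,
    fun h hh a e => ?_⟩
  have hpos := lt_of_le_of_ne (marginal_nonneg i (othersProb_nonneg σ π i) h) hh.symm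
  have hle (e : E) (_ : e ∈ Finset.univ) : subjectiveEnv σ π i h a e ≤
      completion hO T (encHist h ++ [.inl a]) (.inr e) := by
    refine le_trans ?_ ((hq _).lower _)
    rw [subjectiveEnv_eq, div_le_iff₀ hpos]
    exact hT h a e
  -- Termwise inequality between two families with the same sum 1 forces equality.
  refine (Finset.sum_eq_sum_iff_of_le hle).mp ?_ e (Finset.mem_univ e)
  rw [(hq _).sum_inr]
  simp only [subjectiveEnv_eq]
  rw [← Finset.sum_div, sum_marginal_concat, div_self hh]

end Equilibrium

end

end ReflGame

theorem mainTheorem9 {A E : Type*} [Fintype A] [Fintype E] [Primcodable A] [Primcodable E]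
    (r : E → ℝ) (hr : ∀ e, 0 ≤ r e ∧ r e ≤ 1)
    (γ : ℕ → ℝ) (hγ : ∀ t, 0 ≤ γ t) (hγ' : Summable γ)
    (O : ReflGame.Oracle (A ⊕ E)) (hO : ReflGame.IsReflective O)
    (n : ℕ) (σ : ReflGame.Game n A E) (hσ : ReflGame.IsROCGame O σ)
    (π : Fin n → ReflGame.Policy A E) (hπ : ∀ i, ReflGame.IsROCPolicy O (π i))
    (hopt : ∀ i,
      ReflGame.IsAsymptoticallyOptimal r γ (ReflGame.reflEnvironments hO) (π i)) :
    ∀ ε : ℝ, 0 < ε → ∀ i : Fin n,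
      Tendsto
        (fun t : ℕ =>
          ReflGame.gameProbThat σ π t (ReflGame.IsBestResponseAt r γ σ π i ε))
        atTop (𝓝 1) := by
  classical
  intro ε hε i
  obtain ⟨μ, hμ, hμ0, hμ1, hagree⟩ := ReflGame.exists_reflEnvironment_agree σ π i hO hσ hπ
  have hlim := hopt i μ hμ
  set P : List (A × E) → Prop := fun h =>
    ReflGame.optValue r γ (ReflGame.subjectiveEnv σ π i) h
      - ReflGame.value r γ (ReflGame.subjectiveEnv σ π i) (π i) h < ε with hP
  have hnil : ReflGame.marginal i (ReflGame.othersProb σ π i) [] ≠ 0 := by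
    simp [ReflGame.marginal_nil, ReflGame.othersProb_nil]
  -- Being a best response depends only on player `i`'s own history, whose law under the game is the
  -- law of `π i` interacting with `μ`.
  have hgame (t : ℕ) : ReflGame.gameProbThat σ π t (ReflGame.IsBestResponseAt r γ σ π i ε) =
      ∑ w : Fin t → A × E,
        if P (List.ofFn w) then ReflGame.contProb μ (π i) [] (List.ofFn w) else 0 := by
    have h := ReflGame.sum_marginal i
      (fun H => if P (ReflGame.view i H) then ReflGame.gameProb σ π H else 0) t
    refine Eq.trans ?_ (h.symm.trans (Finset.sum_congr rfl fun w _ => ?_))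
    · exact Finset.sum_congr rfl fun w _ => by congr
    · have := ReflGame.marginal_congr i (h := List.ofFn w)
        (F := fun H => if P (ReflGame.view i H) then ReflGame.gameProb σ π H else 0)
        (G := fun H => (if P (List.ofFn w) then 1 else 0) * ReflGame.gameProb σ π H)
        fun H hH => by simp [hH]
      rw [this, ReflGame.marginal_const_mul, ← ReflGame.contProb_subjectiveEnv,
        (ReflGame.contProb_congr_of_agree σ π i hagree hnil (π i) _).1]
      simp
  have hsum (t : ℕ) := ReflGame.sum_contProb hμ1 (π i) [] t
  have hc0 (w : List (A × E)) := ReflGame.contProb_nonneg hμ0 (π i) [] w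
  have hlim' := (hlim.div_const ε).const_sub 1
  rw [zero_div, sub_zero] at hlim'
  refine tendsto_of_tendsto_of_tendsto_of_le_of_le hlim' tendsto_const_nhds
    (fun t => ?_) fun t => ?_
  · simp only [hgame]
    -- Markov's inequality, term by term: where the gap is at least `ε`, the weight is at most
    -- weight times gap over `ε`.
    rw [sub_le_comm, ← hsum t, ← Finset.sum_sub_distrib, Finset.sum_div]
    refine Finset.sum_le_sum fun w _ => ?_
    have hgap : 0 ≤ ReflGame.optValue r γ μ (List.ofFn w)
        - ReflGame.value r γ μ (π i) (List.ofFn w) :=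
      sub_nonneg.mpr (ReflGame.value_le_optValue hμ0 hμ1 hr hγ hγ' _ _)
    split_ifs with hPw
    · rw [sub_self]
      exact div_nonneg (mul_nonneg (hc0 _) hgap) hε.le
    · by_cases hc : ReflGame.contProb μ (π i) [] (List.ofFn w) = 0
      · simp [hc]
      · have hreach :=
          (ReflGame.contProb_congr_of_agree σ π i hagree hnil (π i) (List.ofFn w)).2 hc
        rw [List.nil_append] at hreach
        have hcongr (ρ : ReflGame.Policy A E) (v : List (A × E)) :=
          (ReflGame.contProb_congr_of_agree σ π i hagree hreach ρ v).1
        simp only [hP, ReflGame.optValue_congr hcongr, ReflGame.value_congr (hcongr (π i)),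
          not_lt] at hPw
        rw [sub_zero, le_div_iff₀ hε]
        exact mul_le_mul_of_nonneg_left hPw (hc0 _)
  · simp only [hgame]
    rw [← hsum t]
    refine Finset.sum_le_sum fun w _ => ?_
    split_ifs
    · rfl
    · exact hc0 _
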